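/- A vacuum color graph $G$ is a finite graph with two types of trivalent vertices: fundamental vertices, with one ingoing and one outgoing oriented half-edge and one non-oriented half-edge, and adjoint vertices, with three non-oriented half-edges in a fixed cyclic (counter-clockwise) order. Every outgoing half-edge is glued to an ingoing one, forming an oriented edge, and the non-oriented half-edges are glued in pairs, forming non-oriented edges (multiple edges and self-loops are allowed). Let $v_G$, $e_G$, $h_G$, $f_G$ be the numbers of vertices, edges, independent cycles (the dimension of the cycle space) and oriented cycles (the cycles that remain when the non-oriented edges are removed). For an integer $N\ge1$ let $T^1,\dots,T^{N^2-1}$ be an orthonormal basis of $\mathrm{sl}(N)$, i.e. traceless complex $N\times N$ matrices with $\mathrm{Tr}\,T^iT^j=\delta_{i,j}$, and let $f_{ijk}=\mathrm{Tr}\,[T^i,T^j]T^k$. Label the oriented edges by $a\in\{1,\dots,N\}$ and the non-oriented edges by $i\in\{1,\dots,N^2-1\}$. Attach $T^i_{ab}$ to every fundamental vertex with ingoing edge $a$, outgoing edge $b$ and non-oriented edge $i$, and $f_{ijk}$ to every adjoint vertex with edges $i,j,k$ in counter-clockwise order. The contraction of $G$ at $N$ is the sum over all labelings of the product of these factors.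 **Proposition 2.6.** Let $G$ be a connected vacuum color graph with $v_G\ge1$. There is a unique Laurent polynomial $R_G(N)\in\mathbb{Z}[N,N^{-1}]$, the color factor of $G$, whose value at every integer $N\ge1$ is the contraction of $G$ at $N$ in every orthonormal basis of $\mathrm{sl}(N)$. It has the following properties. 1. $R_G(N)$ is divisible by $N^2-1$ in $\mathbb{Z}[N,N^{-1}]$. 2. If $G$ contains two adjoint vertices $p\neq q$ and three further pairwise distinct adjoint vertices, each of which is joined to both $p$ and $q$ by non-oriented edges, then $R_G(N)=0$. 3. Every exponent of $N$ which occurs in $R_G(N)$ with non-zero coefficient is $\ge -h_G+2$. If $G$ has a fundamental vertex, then $\deg R_G(N)\le h_G$; otherwise $\deg R_G(N)\le h_G+1$. (Here $\deg 0=-\infty$.) 4. $R_G(-N)=(-1)^{f_G+e_G}R_G(N)$. -/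

import Mathlib

open scoped LaurentPolynomial

noncomputable section

/-- A vacuum color graph (every half-edge is paired) with fundamental vertices `F` and adjoint
vertices `A`.

* A fundamental vertex has one ingoing and one outgoing oriented half-edge and one non-oriented
  half-edge. The oriented edges join the outgoing half-edge of `v` to the ingoing half-edge of
  `next v`; so they are indexed by `F`, and `next` is a permutation.
* An adjoint vertex `a` has three non-oriented half-edges `(a, 0), (a, 1), (a, 2)`, listed in
  counter-clockwise order (the ribbon structure).
* `pair` glues the non-oriented half-edges in pairs to non-oriented edges.

The cyclic order of the three half-edges at a fundamental vertex is not recorded: the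
tensor `T^i_{ab}` attached to the vertex does not depend on it. There are no components without
vertices. -/
structure ColorGraph (F A : Type*) where
  /-- the head of the oriented edge which leaves a fundamental vertex -/
  next : Equiv.Perm F
  /-- the other half of a non-oriented edge -/
  pair : Equiv.Perm (F ⊕ A × Fin 3)
  pair_pair : ∀ h, pair (pair h) = h
  pair_ne : ∀ h, pair h ≠ h

namespace ColorGraph

variable {F A : Type*}

/-- The vertex to which a non-oriented half-edge is attached. -/
def vertexOf : F ⊕ A × Fin 3 → F ⊕ A
  | .inl v => .inl v
  | .inr (a, _) => .inr a

/-- The number `v_G` of vertices. -/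
def numVertices (_G : ColorGraph F A) : ℕ := Nat.card (F ⊕ A)

/-- The number `e_G` of edges: the oriented edges, one for each fundamental vertex where it
starts, and the non-oriented edges, which are the orbits of `pair`. -/
def numEdges (G : ColorGraph F A) : ℕ :=
  Nat.card F + Nat.card (Quotient (Equiv.Perm.SameCycle.setoid G.pair))

/-- The number `f_G` of oriented cycles, i.e. of the orbits of `next` (fixed points, which are
oriented cycles through a single vertex, included). -/
def numOrientedCycles (G : ColorGraph F A) : ℕ :=
  Nat.card (Quotient (Equiv.Perm.SameCycle.setoid G.next))

/-- The simple graph of adjacency of distinct vertices. -/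
def toSimpleGraph (G : ColorGraph F A) : SimpleGraph (F ⊕ A) :=
  SimpleGraph.fromRel fun x y =>
    (∃ v, x = .inl v ∧ y = .inl (G.next v)) ∨ ∃ h, x = vertexOf h ∧ y = vertexOf (G.pair h)

/-- The graph is connected (in particular it has a vertex). -/
def Connected (G : ColorGraph F A) : Prop := G.toSimpleGraph.Connected

/-- The cycle space (first homology with rational coefficients) of the graph: the flows `(φ, ψ)`
obeying Kirchhoff's law at every vertex. Here `φ v` is the flow through the oriented edge which
starts at `v`, and `ψ h` is the flow which leaves a vertex through its non-oriented
half-edge `h`. -/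
def cycleSpace (G : ColorGraph F A) : Submodule ℚ ((F → ℚ) × (F ⊕ A × Fin 3 → ℚ)) where
  carrier := {c | (∀ h, c.2 (G.pair h) = -c.2 h) ∧
    (∀ v, c.1 v - c.1 (G.next.symm v) + c.2 (.inl v) = 0) ∧
    ∀ a, ∑ k : Fin 3, c.2 (.inr (a, k)) = 0}
  zero_mem' := by simp
  add_mem' := by
    rintro c d ⟨h1, h2, h3⟩ ⟨k1, k2, k3⟩
    refine ⟨fun h => ?_, fun v => ?_, fun a => ?_⟩
    · simp only [Prod.snd_add, Pi.add_apply, h1, k1]; ring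
    · simp only [Prod.snd_add, Prod.fst_add, Pi.add_apply]; linear_combination h2 v + k2 v
    · simp only [Prod.snd_add, Pi.add_apply, Finset.sum_add_distrib, h3, k3, add_zero]
  smul_mem' := by
    rintro r c ⟨h1, h2, h3⟩
    refine ⟨fun h => ?_, fun v => ?_, fun a => ?_⟩
    · simp only [Prod.smul_snd, Pi.smul_apply, smul_eq_mul, h1]; ring
    · simp only [Prod.smul_snd, Prod.smul_fst, Pi.smul_apply, smul_eq_mul]
      linear_combination r * h2 v
    · simp only [Prod.smul_snd, Pi.smul_apply, smul_eq_mul, ← Finset.mul_sum, h3, mul_zero]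

/-- The number `h_G` of independent cycles (loops). -/
def loopNumber (G : ColorGraph F A) : ℕ := Module.finrank ℚ G.cycleSpace

/-- A non-oriented edge joins the adjoint vertices `a` and `b`. -/
def AdjointEdge (G : ColorGraph F A) (a b : A) : Prop :=
  ∃ i j : Fin 3, G.pair (.inr (a, i)) = .inr (b, j)

/-- The graph contains two adjoint vertices `p ≠ q` and three further, mutually distinct adjoint
vertices each of which is joined to both `p` and `q` by non-oriented edges: a non-oriented
`K_{2,3}`. The cyclic orders at its vertices are left arbitrary. -/
def ContainsTwoThree (G : ColorGraph F A) : Prop :=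
  ∃ (p q : A) (c : Fin 3 → A), p ≠ q ∧ Function.Injective c ∧
    ∀ k, c k ≠ p ∧ c k ≠ q ∧ G.AdjointEdge p (c k) ∧ G.AdjointEdge q (c k)

end ColorGraph

/-- An orthonormal basis of `sl(N)`: traceless matrices with `Tr (T^i T^j) = δ_{ij}`. Orthonormality
makes them linearly independent, and their number `N ^ 2 - 1` is the dimension of `sl(N)`. -/
structure IsOrthonormalBasisSl {N : ℕ} (T : Fin (N ^ 2 - 1) → Matrix (Fin N) (Fin N) ℂ) :
    Prop where
  trace_eq_zero : ∀ i, (T i).trace = 0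
  trace_mul : ∀ i j, (T i * T j).trace = if i = j then 1 else 0

/-- The structure constants `f_{ijk} = Tr ([T^i, T^j] T^k)`. -/
def structureConstant {N : ℕ} (T : Fin (N ^ 2 - 1) → Matrix (Fin N) (Fin N) ℂ)
    (i j k : Fin (N ^ 2 - 1)) : ℂ :=
  ((T i * T j - T j * T i) * T k).trace

namespace ColorGraph

variable {F A : Type*}

open Classical in
/-- The contraction given by the Feynman rules: `T^i_{ab}` at every fundamental vertex with
ingoing `a`, outgoing `b` and non-oriented `i`, and `f_{ijk}` at every adjoint vertex with
counter-clockwise `i, j, k`, summed over all labels `x` of the oriented edges (the edge starting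
at `v` has label `x v`) and all labels `i` of the non-oriented edges (equal labels on
the two halves of an edge). -/
def contraction [Fintype F] [Fintype A] (G : ColorGraph F A) {N : ℕ}
    (T : Fin (N ^ 2 - 1) → Matrix (Fin N) (Fin N) ℂ) : ℂ :=
  ∑ i : {i : F ⊕ A × Fin 3 → Fin (N ^ 2 - 1) // ∀ h, i (G.pair h) = i h}, ∑ x : F → Fin N,
    (∏ v : F, T (i.1 (.inl v)) (x (G.next.symm v)) (x v)) *
      ∏ a : A, structureConstant T (i.1 (.inr (a, 0))) (i.1 (.inr (a, 1))) (i.1 (.inr (a, 2)))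

/-- The Laurent polynomial `R` is the color factor `R_G(N) ∈ ℤ[N, 1/N]` of `G`: for every
`N ≥ 1` its value at `N` is the contraction of `G` in any orthonormal basis of `sl(N)`. -/
def IsColorFactor [Fintype F] [Fintype A] (G : ColorGraph F A) (R : ℤ[T;T⁻¹]) : Prop :=
  ∀ (N : ℕ) (hN : (N : ℂ) ≠ 0) (T : Fin (N ^ 2 - 1) → Matrix (Fin N) (Fin N) ℂ),
    IsOrthonormalBasisSl T →
      LaurentPolynomial.eval₂ (Int.castRingHom ℂ) (Units.mk0 (N : ℂ) hN) R = G.contraction T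

end ColorGraph

/-- The unit `N` of `ℤ[N, 1/N]`. -/
def laurentVar : ℤ[T;T⁻¹]ˣ where
  val := LaurentPolynomial.T 1
  inv := LaurentPolynomial.T (-1)
  val_inv := by rw [← LaurentPolynomial.T_add]; simp
  inv_val := by rw [← LaurentPolynomial.T_add]; simp

/-- The substitution `R(N) ↦ R(-N)` in `ℤ[N, 1/N]`. -/
def substNeg : ℤ[T;T⁻¹] →+* ℤ[T;T⁻¹] :=
  LaurentPolynomial.eval₂ LaurentPolynomial.C (-laurentVar)

end

/-! The proof is 't Hooft's double line expansion, with ribbon graphs encoded as permutations of the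
half-edges. A structure constant is a difference of two traces, so each adjoint vertex is a signed
sum over the two cyclic orders of an oriented triangle of fundamental vertices. A choice `ε` of
orders gives a permutation `σ = G.orient ε` of the non-oriented half-edges. The completeness
relation of `sl(N)` then replaces each non-oriented edge by a double line, or by `-1/N` times its
deletion. If `S` is the set of double lines, summing over the indices gives `N` to the number of
orbits of `flipOn m S * σ`. Deleting an edge at an adjoint vertex contributes nothing: the two
orders there give the same power of `N` with opposite signs. What remains is `colorPolynomial`.
Uniqueness holds because orthonormal bases exist for every `N ≥ 1`.

Write `c` for the number of orbits. The exponents are `c(flipOn m S * σ) - |Sᶜ|`. Parity: the sign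
of a permutation determines the parity of its number of orbits, 3-cycles are even and each flipped
edge is a transposition, so the parity of the exponent depends on neither `ε` nor `S`. Divisibility:
`sl(1) = 0` gives the root `1`, and parity then gives the root `-1`. Lower bound: `c ≥ 1`, and
deleted edges use up two fundamental vertices each. Upper bound: Euler's inequality for ribbon
graphs (`cycleCount_flipOn_mul_add_le`). Both bounds are expressed through the loop number by
rank-nullity for the boundary map. Vanishing: exchanging `p` and `q` is a symmetry of the graph
which reverses an odd number of cyclic orders, so the contraction equals its negative. -/

open scoped LaurentPolynomial

/-! ### Merging two classes of an equivalence relation -/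

section SetoidMerge

variable {α : Type*}

/-- The smallest equivalence relation containing `r` which identifies `a` and `b`. -/
noncomputable def Setoid.merge (r : Setoid α) (a b : α) : Setoid α :=
  open Classical in Setoid.ker fun x => if r x a then Quotient.mk r b else Quotient.mk r x

open Classical in
theorem Setoid.merge_apply {r : Setoid α} {a b x y : α} :
    r.merge a b x y ↔ (if r x a then Quotient.mk r b else Quotient.mk r x) =
      if r y a then Quotient.mk r b else Quotient.mk r y := Iff.rfl

theorem Setoid.le_merge (r : Setoid α) (a b : α) : r ≤ r.merge a b := by
  classical
  intro x y h
  rw [Setoid.merge_apply]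
  by_cases hx : r x a
  · have hy : r y a := r.trans' (r.symm' h) hx
    simp [hx, hy]
  · have hy : ¬ r y a := fun hy => hx (r.trans' h hy)
    simpa [hx, hy] using Quotient.sound h

theorem Setoid.merge_rel (r : Setoid α) (a b : α) : r.merge a b a b := by
  classical
  rw [Setoid.merge_apply]
  simp

theorem Setoid.merge_le {r s : Setoid α} {a b : α} (h : r ≤ s) (hab : s a b) :
    r.merge a b ≤ s := by
  classical
  intro x y hxy
  rw [Setoid.merge_apply] at hxy
  split_ifs at hxy with h1 h2 h2
  · exact h (r.trans' h1 (r.symm' h2))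
  · exact s.trans' (h h1) (s.trans' hab (h (Quotient.exact hxy)))
  · exact s.trans' (h (Quotient.exact hxy)) (s.symm' (s.trans' (h h2) hab))
  · exact h (Quotient.exact hxy)

theorem Setoid.card_quotient_le_of_le [Finite α] {r s : Setoid α} (h : r ≤ s) :
    Nat.card (Quotient s) ≤ Nat.card (Quotient r) :=
  Nat.card_le_card_of_surjective (Quotient.map' id fun _ _ hxy => h hxy) <| by
    rintro ⟨x⟩
    exact ⟨Quotient.mk r x, rfl⟩

theorem Setoid.card_quotient_le_merge [Finite α] (r : Setoid α) (a b : α) :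
    Nat.card (Quotient r) ≤ Nat.card (Quotient (r.merge a b)) + 1 := by
  classical
  rw [← Finite.card_option]
  -- The only class lost by merging is that of `a`, which `none` supplies.
  refine Nat.card_le_card_of_surjective (fun q : Option (Quotient (r.merge a b)) =>
    q.elim (Quotient.mk r a) (Quotient.lift
      (fun x => if r x a then Quotient.mk r b else Quotient.mk r x) fun x y h => h)) ?_
  rintro ⟨x⟩
  by_cases hx : r x a
  · exact ⟨none, (Quotient.sound hx).symm⟩
  · exact ⟨some (Quotient.mk _ x), if_neg hx⟩

theorem Setoid.card_quotient_merge_lt [Finite α] (r : Setoid α) {a b : α} (h : ¬ r a b) :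
    Nat.card (Quotient (r.merge a b)) < Nat.card (Quotient r) := by
  classical
  have := Fintype.ofFinite (Quotient r)
  have := Fintype.ofFinite (Quotient (r.merge a b))
  rw [Nat.card_eq_fintype_card, Nat.card_eq_fintype_card]
  refine Fintype.card_lt_of_surjective_not_injective
    (Quotient.map' id fun _ _ hxy => r.le_merge a b hxy) ?_ ?_
  · rintro ⟨x⟩
    exact ⟨Quotient.mk r x, rfl⟩
  · intro hinj
    exact h (Quotient.exact (hinj (a₁ := Quotient.mk r a) (a₂ := Quotient.mk r b)
      (Quotient.sound (r.merge_rel a b))))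

end SetoidMerge

/-! ### Numbers of orbits and signs of permutations -/

namespace Equiv.Perm

variable {α : Type*}

/-- The number of orbits of a permutation, fixed points included. -/
noncomputable def cycleCount (σ : Perm α) : ℕ := Nat.card (Quotient (SameCycle.setoid σ))

theorem sameCycle_setoid_le_iff {σ : Perm α} {r : Setoid α} :
    SameCycle.setoid σ ≤ r ↔ ∀ x, r x (σ x) := by
  refine ⟨fun h x => h (show σ.SameCycle x (σ x) from ⟨1, by simp⟩), fun h => ?_⟩
  rintro x y ⟨n, rfl⟩
  have hinv : ∀ x, r x (σ⁻¹ x) := fun x => by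
    have := h (σ⁻¹ x)
    rw [show σ (σ⁻¹ x) = x from σ.apply_symm_apply x] at this
    exact r.symm' this
  induction n using Int.induction_on with
  | zero => exact r.refl' x
  | succ n ih =>
    rw [add_comm, zpow_add, zpow_one, mul_apply]
    exact r.trans' ih (h _)
  | pred n ih =>
    rw [sub_eq_add_neg, add_comm, zpow_add, zpow_neg_one, mul_apply]
    exact r.trans' ih (hinv _)

theorem card_invariant [Finite α] (β : Type*) (σ : Perm α) :
    Nat.card {x : α → β // ∀ a, x (σ a) = x a} = Nat.card β ^ σ.cycleCount := by
  have e : {x : α → β // ∀ a, x (σ a) = x a} ≃ (Quotient (SameCycle.setoid σ) → β) :=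
    { toFun := fun x => Quotient.lift x.1 fun a b h =>
        (sameCycle_setoid_le_iff (r := Setoid.ker x.1)).2 (fun a => (x.2 a).symm) h
      invFun := fun y => ⟨fun a => y (Quotient.mk _ a), fun a =>
        congrArg y (Quotient.sound (SameCycle.symm ⟨1, by simp⟩))⟩
      left_inv := fun x => rfl
      right_inv := fun y => by
        ext ⟨a⟩
        rfl }
  rw [Nat.card_congr e, Nat.card_fun, cycleCount]

theorem cycleCount_pos [Finite α] [Nonempty α] (σ : Perm α) : 0 < σ.cycleCount :=
  Nat.card_pos_iff.2 ⟨⟨Quotient.mk _ (Classical.arbitrary α)⟩, inferInstance⟩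

theorem cycleCount_eq [DecidableEq α] [Fintype α] (σ : Perm α) :
    σ.cycleCount = σ.cycleFactorsFinset.card + (Finset.univ \ σ.support).card := by
  classical
  let g : α → Perm α ⊕ α := fun x => if σ x = x then .inr x else .inl (σ.cycleOf x)
  have hg : SameCycle.setoid σ = Setoid.ker g := by
    ext x y
    rw [Setoid.ker_def]
    change σ.SameCycle x y ↔ _
    by_cases hx : σ x = x <;> by_cases hy : σ y = y <;> simp only [g, hx, hy, if_true, if_false]
    · rw [Sum.inr.injEq]
      exact ⟨fun h => h.eq_of_left hx, fun h => h ▸ SameCycle.refl _ _⟩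
    · simp only [reduceCtorEq, iff_false]
      exact fun h => hy (h.apply_eq_self_iff.1 hx)
    · simp only [reduceCtorEq, iff_false]
      exact fun h => hx (h.apply_eq_self_iff.2 hy)
    · rw [Sum.inl.injEq]
      exact sameCycle_iff_cycleOf_eq_of_mem_support (mem_support.2 hx) (mem_support.2 hy)
  have hr : Set.range g = ↑(σ.cycleFactorsFinset.disjSum (Finset.univ \ σ.support)) := by
    ext c
    simp only [Set.mem_range, Finset.mem_coe, Finset.mem_disjSum, Finset.mem_sdiff,
      Finset.mem_univ, true_and, mem_support, not_not, g]
    constructor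
    · rintro ⟨x, rfl⟩
      by_cases hx : σ x = x
      · exact Or.inr ⟨x, hx, by simp [hx]⟩
      · exact Or.inl ⟨_, cycleOf_mem_cycleFactorsFinset_iff.2 (mem_support.2 hx), by simp [hx]⟩
    · rintro (⟨c, hc, rfl⟩ | ⟨x, hx, rfl⟩)
      · obtain ⟨x, hx⟩ := (mem_cycleFactorsFinset_iff.1 hc).1.nonempty_support
        refine ⟨x, ?_⟩
        have hx' := mem_support.1 (mem_cycleFactorsFinset_support_le hc hx)
        rw [if_neg hx', cycle_is_cycleOf hx hc]
      · exact ⟨x, by simp [hx]⟩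
  rw [cycleCount, hg, Nat.card_congr (Setoid.quotientKerEquivRange g), hr, Nat.card_eq_card_toFinset,
    Finset.toFinset_coe, Finset.card_disjSum]

theorem sign_eq_neg_one_pow_cycleCount [DecidableEq α] [Fintype α] (σ : Perm α) :
    sign σ = (-1) ^ (Fintype.card α + σ.cycleCount) := by
  have h1 : σ.cycleType.card = σ.cycleFactorsFinset.card := by
    rw [cycleType_def, Multiset.card_map]; rfl
  have h2 : (Finset.univ \ σ.support).card + σ.support.card = Fintype.card α := by
    rw [Finset.card_sdiff_add_card_eq_card (Finset.subset_univ _), Finset.card_univ]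
  rw [sign_of_cycleType, sum_cycleType, h1, cycleCount_eq, ← h2]
  -- The two exponents differ by twice the number of fixed points.
  rw [show (Finset.univ \ σ.support).card + σ.support.card + (σ.cycleFactorsFinset.card +
    (Finset.univ \ σ.support).card) = (σ.support.card + σ.cycleFactorsFinset.card) +
    2 * (Finset.univ \ σ.support).card by ring, pow_add _ _ (2 * _), pow_mul]
  simp

theorem sameCycle_swap_mul_le [DecidableEq α] (σ : Perm α) (a b : α) :
    SameCycle.setoid (swap a b * σ) ≤ (SameCycle.setoid σ).merge a b := by
  rw [sameCycle_setoid_le_iff]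
  intro x
  set r := (SameCycle.setoid σ).merge a b with hr
  have hx : r x (σ x) := sameCycle_setoid_le_iff.1 ((SameCycle.setoid σ).le_merge a b) x
  have hab : r a b := (SameCycle.setoid σ).merge_rel a b
  rw [mul_apply, swap_apply_def]
  split_ifs with h1 h2
  · rw [h1] at hx; exact r.trans' hx hab
  · rw [h2] at hx; exact r.trans' hx (r.symm' hab)
  · exact hx

/-- The swap is an involution, so the orbits of `σ` and of `swap a b * σ` generate the same relation
once `a` and `b` are identified. -/
theorem cycleCount_swap_mul_le_merge [DecidableEq α] [Finite α] (σ : Perm α) (a b : α) :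
    (swap a b * σ).cycleCount ≤ Nat.card (Quotient ((SameCycle.setoid σ).merge a b)) + 1 := by
  refine ((SameCycle.setoid (swap a b * σ)).card_quotient_le_merge a b).trans
    (Nat.add_le_add_right (Setoid.card_quotient_le_of_le ?_) 1)
  refine Setoid.merge_le ?_ (Setoid.merge_rel _ a b)
  conv_lhs => rw [← swap_mul_self_mul a b σ]
  exact sameCycle_swap_mul_le _ a b

theorem cycleCount_swap_mul_le [DecidableEq α] [Finite α] (σ : Perm α) (a b : α) :
    (swap a b * σ).cycleCount ≤ σ.cycleCount + 1 :=
  (cycleCount_swap_mul_le_merge σ a b).trans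
    (Nat.add_le_add_right (Setoid.card_quotient_le_of_le (Setoid.le_merge _ a b)) 1)

/-- Merging gives the weak inequality; equality is impossible because a transposition changes the
sign and hence the parity of the number of orbits. -/
theorem cycleCount_swap_mul_lt [DecidableEq α] [Finite α] {σ : Perm α} {a b : α}
    (h : ¬ σ.SameCycle a b) : (swap a b * σ).cycleCount < σ.cycleCount := by
  have := Fintype.ofFinite α
  have hlt := Setoid.card_quotient_merge_lt (SameCycle.setoid σ) h
  have hle : (swap a b * σ).cycleCount ≤ σ.cycleCount :=
    (cycleCount_swap_mul_le_merge σ a b).trans hlt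
  refine lt_of_le_of_ne hle fun heq => ?_
  have hab : a ≠ b := fun hab => h (hab ▸ SameCycle.refl _ _)
  have h1 := sign_eq_neg_one_pow_cycleCount (swap a b * σ)
  rw [heq, ← sign_eq_neg_one_pow_cycleCount, sign_mul, sign_swap hab] at h1
  have h2 := mul_eq_right.1 h1
  exact absurd h2 (by decide)

end Equiv.Perm

/-! ### Perfect matchings and the genus bound -/

namespace Equiv.Perm

/-- A fixed point free involution is a perfect matching, whose edges are its orbits. -/
theorem exists_matching {α : Type*} (π : Perm α) (h2 : ∀ x, π (π x) = x) (hne : ∀ x, π x ≠ x) :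
    ∃ m : Quotient (SameCycle.setoid π) × Bool ≃ α, ∀ e b, π (m (e, b)) = m (e, !b) := by
  have hs : ∀ x y, π.SameCycle x y → y = x ∨ y = π x := by
    rintro x y ⟨n, rfl⟩
    have hsq : π ^ (2 : ℤ) = 1 := by
      ext x
      rw [zpow_ofNat, pow_two, mul_apply, h2, one_apply]
    obtain ⟨k, rfl | rfl⟩ := Int.even_or_odd' n
    · left; rw [zpow_mul, hsq, one_zpow, one_apply]
    · right; rw [zpow_add, zpow_mul, hsq, one_zpow, one_mul, zpow_one]
  have hπ : ∀ x, π.SameCycle x (π x) := fun x => ⟨1, by simp⟩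
  have hmk : ∀ e : Quotient (SameCycle.setoid π), ∀ b : Bool,
      Quotient.mk (SameCycle.setoid π) (if b then e.out else π e.out) = e := by
    intro e b
    cases b
    · exact (Quotient.sound (hπ e.out).symm).trans e.out_eq
    · exact e.out_eq
  refine ⟨Equiv.ofBijective
    (fun p : Quotient (SameCycle.setoid π) × Bool => if p.2 then p.1.out else π p.1.out)
    ⟨?_, ?_⟩, ?_⟩
  · rintro ⟨e, b⟩ ⟨e', b'⟩ h
    have he : e = e' := by rw [← hmk e b, ← hmk e' b']; exact congrArg _ h
    subst he
    cases b <;> cases b' <;> simp_all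
    exact hne _ h.symm
  · intro x
    rcases hs _ _ (Quotient.exact (Quotient.mk (SameCycle.setoid π) x).out_eq) with h | h
    · exact ⟨(Quotient.mk _ x, true), h.symm⟩
    · exact ⟨(Quotient.mk _ x, false), h.symm⟩
  · rintro e (_ | _)
    · exact h2 e.out
    · rfl

section Matching

variable {E H : Type*} [DecidableEq E]

/-- The involution which interchanges the end points of the edges in `S` of a matching. -/
def flipOn (m : E × Bool ≃ H) (S : Finset E) : Perm H :=
  m.permCongr (Equiv.prodCongrRight fun e => if e ∈ S then Equiv.boolNot else Equiv.refl Bool)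

theorem flipOn_apply (m : E × Bool ≃ H) (S : Finset E) (e : E) (b : Bool) :
    flipOn m S (m (e, b)) = m (e, if e ∈ S then !b else b) := by
  simp only [flipOn, permCongr_apply, symm_apply_apply, prodCongrRight_apply]
  split_ifs <;> simp

theorem flipOn_flipOn (m : E × Bool ≃ H) (S : Finset E) (h : H) :
    flipOn m S (flipOn m S h) = h := by
  obtain ⟨⟨e, b⟩, rfl⟩ := m.surjective h
  rw [flipOn_apply, flipOn_apply]
  split_ifs <;> simp

theorem flipOn_empty (m : E × Bool ≃ H) : flipOn m ∅ = 1 := by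
  ext h
  obtain ⟨⟨e, b⟩, rfl⟩ := m.surjective h
  simp [flipOn_apply]

theorem flipOn_insert [DecidableEq H] (m : E × Bool ≃ H) {S : Finset E} {e : E} (he : e ∉ S) :
    flipOn m (insert e S) = swap (m (e, true)) (m (e, false)) * flipOn m S := by
  ext h
  obtain ⟨⟨e', b⟩, rfl⟩ := m.surjective h
  rw [mul_apply, flipOn_apply, flipOn_apply]
  by_cases h' : e' = e
  · subst h'
    cases b <;> simp [he]
  · rw [swap_apply_of_ne_of_ne] <;> simp [h']

theorem sign_flipOn [DecidableEq H] [Fintype H] (m : E × Bool ≃ H) (S : Finset E) :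
    sign (flipOn m S) = (-1) ^ S.card := by
  induction S using Finset.induction_on with
  | empty => simp [flipOn_empty]
  | insert e S he ih =>
    rw [flipOn_insert m he, sign_mul, ih, sign_swap (by simp), Finset.card_insert_of_notMem he,
      pow_succ']

/-- Euler's inequality `V - E + F ≤ 2k` for a ribbon graph: the vertices are the orbits of `σ`, the
edges are `S`, the faces are the orbits of `flipOn m S * σ`, and the classes of `r` play the role of
the `k` components. Edges are added one at a time. -/
theorem exists_setoid_cycleCount_flipOn_mul [Finite H] (m : E × Bool ≃ H) (σ : Perm H)
    (S : Finset E) : ∃ r : Setoid H, (∀ x, r x (σ x)) ∧ (∀ x, r x (flipOn m S x)) ∧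
      (flipOn m S * σ).cycleCount + σ.cycleCount ≤ 2 * Nat.card (Quotient r) + S.card := by
  classical
  induction S using Finset.induction_on with
  | empty =>
    refine ⟨SameCycle.setoid σ, sameCycle_setoid_le_iff.1 le_rfl, ?_, ?_⟩
    · intro x
      rw [flipOn_empty]
      exact Setoid.refl' _ x
    · rw [flipOn_empty, one_mul, Finset.card_empty, cycleCount]
      omega
  | insert e S he ih =>
    obtain ⟨r, hσ, hf, hc⟩ := ih
    set a := m (e, true)
    set b := m (e, false)
    have key : ∀ r' : Setoid H, r ≤ r' → r' a b → ∀ x, r' x (flipOn m (insert e S) x) := by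
      intro r' hr hab x
      have hx := hr (hf x)
      rw [flipOn_insert m he, mul_apply, swap_apply_def]
      split_ifs with h1 h2
      · rw [h1] at hx; exact r'.trans' hx hab
      · rw [h2] at hx; exact r'.trans' hx (r'.symm' hab)
      · exact hx
    rw [Finset.card_insert_of_notMem he, flipOn_insert m he, mul_assoc]
    change ∃ r' : Setoid H, _ ∧ _ ∧ (swap a b * (flipOn m S * σ)).cycleCount + _ ≤ _
    -- An edge inside a class creates at most one face. An edge between two classes destroys at
    -- least one face, which pays for the drop of `2k` by at most 2.
    by_cases hab : r a b
    · refine ⟨r, hσ, flipOn_insert m he ▸ key r le_rfl hab, ?_⟩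
      have := cycleCount_swap_mul_le (flipOn m S * σ) a b
      omega
    · refine ⟨r.merge a b, fun x => r.le_merge a b (hσ x),
        flipOn_insert m he ▸ key _ (r.le_merge a b) (r.merge_rel a b), ?_⟩
      have h1 : ¬ (flipOn m S * σ).SameCycle a b := fun h => hab <|
        sameCycle_setoid_le_iff.2 (fun x => r.trans' (hσ x) (hf _)) h
      have h2 := cycleCount_swap_mul_lt h1
      have h3 := r.card_quotient_le_merge a b
      omega

theorem exists_setoid_matching [Finite H] (m : E × Bool ≃ H) (r : Setoid H) (S : Finset E) :
    ∃ r' : Setoid H, r ≤ r' ∧ (∀ e ∈ S, r' (m (e, true)) (m (e, false))) ∧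
      Nat.card (Quotient r) ≤ Nat.card (Quotient r') + S.card := by
  induction S using Finset.induction_on with
  | empty => exact ⟨r, le_rfl, by simp, by simp⟩
  | insert e S he ih =>
    obtain ⟨r', h1, h2, h3⟩ := ih
    refine ⟨r'.merge (m (e, true)) (m (e, false)), h1.trans (r'.le_merge _ _), ?_, ?_⟩
    · intro e' he'
      rcases Finset.mem_insert.1 he' with rfl | he'
      · exact r'.merge_rel _ _
      · exact r'.le_merge _ _ (h2 e' he')
    · rw [Finset.card_insert_of_notMem he]
      have := r'.card_quotient_le_merge (m (e, true)) (m (e, false))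
      omega

/-- The genus bound: the ribbon graph with vertices the cycles of `σ` and edges a subset `S` of a
connecting matching. -/
theorem cycleCount_flipOn_mul_add_le [Finite H] [Fintype E] (m : E × Bool ≃ H) (σ : Perm H)
    (S : Finset E)
    (hconn : ∀ r : Setoid H, (∀ x, r x (σ x)) → (∀ e, r (m (e, true)) (m (e, false))) → r = ⊤) :
    (flipOn m S * σ).cycleCount + σ.cycleCount ≤ 2 + 2 * Sᶜ.card + S.card := by
  obtain ⟨r, hσ, hf, hc⟩ := exists_setoid_cycleCount_flipOn_mul m σ S
  -- Restoring the deleted edges makes everything connected, and each joins at most two classes; so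
  -- `k ≤ 1 + |Sᶜ|`.
  obtain ⟨r', h1, h2, h3⟩ := exists_setoid_matching m r Sᶜ
  have hr' : r' = ⊤ := by
    refine hconn r' (fun x => h1 (hσ x)) fun e => ?_
    by_cases he : e ∈ S
    · have := hf (m (e, true))
      rw [flipOn_apply, if_pos he] at this
      exact h1 this
    · exact h2 e (Finset.mem_compl.2 he)
  have h4 : Nat.card (Quotient r') ≤ 1 := by
    subst hr'
    have : Subsingleton (Quotient (⊤ : Setoid H)) :=
      ⟨by rintro ⟨x⟩ ⟨y⟩; exact Quotient.sound trivial⟩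
    exact Finite.card_le_one_iff_subsingleton.2 this
  omega

end Matching

end Equiv.Perm

/-! ### Completeness and existence of orthonormal bases of `sl(N)` -/

section OrthonormalBasis

variable {N : ℕ}

/-- The completeness relation of `sl(N)`. -/
theorem IsOrthonormalBasisSl.sum_mul_apply {T : Fin (N ^ 2 - 1) → Matrix (Fin N) (Fin N) ℂ}
    (hT : IsOrthonormalBasisSl T) (hN : N ≠ 0) (a b c d : Fin N) :
    ∑ i, T i a b * T i c d =
      (if a = d ∧ b = c then 1 else 0) + (if a = b ∧ c = d then -(N : ℂ)⁻¹ else 0) := by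
  let A : Matrix (Option (Fin (N ^ 2 - 1))) (Fin N × Fin N) ℂ := fun i p =>
    i.elim (if p.1 = p.2 then 1 else 0) fun i => T i p.1 p.2
  let B : Matrix (Fin N × Fin N) (Option (Fin (N ^ 2 - 1))) ℂ := fun p i =>
    i.elim (if p.1 = p.2 then (N : ℂ)⁻¹ else 0) fun i => T i p.2 p.1
  have hN' : (N : ℂ) ≠ 0 := Nat.cast_ne_zero.2 hN
  -- Orthonormality of the `T i`, completed by the identity matrix, says `A * B = 1`. Both factors
  -- are square of size `N ^ 2`, so `B * A = 1`, whose entries are the completeness relation.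
  have hAB : A * B = 1 := by
    ext i j
    rw [Matrix.mul_apply, Fintype.sum_prod_type]
    rcases i with _ | i <;> rcases j with _ | j
    · simp [A, B, hN']
    · have := hT.trace_eq_zero j
      simpa [A, B, Matrix.trace] using this
    · have := hT.trace_eq_zero i
      simp only [Matrix.trace, Matrix.diag_apply] at this
      simp [A, B, ← Finset.sum_mul, this]
    · have := hT.trace_mul i j
      simp only [Matrix.trace, Matrix.diag_apply, Matrix.mul_apply] at this
      simp [A, B, this, Matrix.one_apply]
  have hcard : Fintype.card (Option (Fin (N ^ 2 - 1))) = Fintype.card (Fin N × Fin N) := by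
    simp only [Fintype.card_option, Fintype.card_fin, Fintype.card_prod]
    rw [← pow_two]
    have : 0 < N ^ 2 := by positivity
    omega
  have hBA := congrFun₂ ((Matrix.mul_eq_one_comm_of_card_eq _ _ _ hcard).1 hAB) (b, a) (c, d)
  rw [Matrix.mul_apply, Fintype.sum_option, Matrix.one_apply] at hBA
  change (if b = a then (N : ℂ)⁻¹ else 0) * (if c = d then 1 else 0) + ∑ i, T i a b * T i c d = _
    at hBA
  rw [eq_sub_of_add_eq' hBA]
  simp only [Prod.mk.injEq, and_comm (a := b = c), eq_comm (a := b) (b := a)]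
  by_cases h1 : a = b <;> by_cases h2 : c = d <;> simp [h1, h2, sub_eq_add_neg]

/-- The trace form stays nondegenerate on `sl(N)`: any `B` is traceless up to a scalar matrix, which
pairs to zero with `A`. -/
theorem Matrix.eq_zero_of_trace_mul_traceless (hN : N ≠ 0) {A : Matrix (Fin N) (Fin N) ℂ}
    (hA : A.trace = 0) (h : ∀ B : Matrix (Fin N) (Fin N) ℂ, B.trace = 0 → (A * B).trace = 0) :
    A = 0 := by
  have hN' : (N : ℂ) ≠ 0 := Nat.cast_ne_zero.2 hN
  rw [Matrix.ext_iff_trace_mul_right]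
  intro B
  have h1 := h (B - (B.trace / N) • 1) (by simp [Matrix.trace_sub, Matrix.trace_smul, hN'])
  rw [Matrix.mul_sub, Matrix.trace_sub, Matrix.mul_smul, Matrix.trace_smul, Matrix.mul_one, hA,
    smul_zero, sub_zero] at h1
  rw [h1, Matrix.zero_mul, Matrix.trace_zero]

theorem exists_isOrthonormalBasisSl (hN : N ≠ 0) :
    ∃ T : Fin (N ^ 2 - 1) → Matrix (Fin N) (Fin N) ℂ, IsOrthonormalBasisSl T := by
  let V : Submodule ℂ (Matrix (Fin N) (Fin N) ℂ) := LinearMap.ker (Matrix.traceLinearMap (Fin N) ℂ ℂ)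
  have hV : ∀ v : V, (v : Matrix (Fin N) (Fin N) ℂ).trace = 0 := fun v => v.2
  have hdim : Module.finrank ℂ V = N ^ 2 - 1 := by
    have h1 := LinearMap.finrank_range_add_finrank_ker (Matrix.traceLinearMap (Fin N) ℂ ℂ)
    have hs : LinearMap.range (Matrix.traceLinearMap (Fin N) ℂ ℂ) = ⊤ := by
      rw [LinearMap.range_eq_top]
      intro c
      refine ⟨(c / N) • 1, ?_⟩
      have hN' : (N : ℂ) ≠ 0 := Nat.cast_ne_zero.2 hN
      simp [hN']
    rw [hs, finrank_top, Module.finrank_self, Module.finrank_matrix] at h1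
    simp only [Fintype.card_fin, Module.finrank_self, mul_one] at h1
    rw [pow_two]
    change 1 + Module.finrank ℂ V = _ at h1
    omega
  let B : LinearMap.BilinForm ℂ V := LinearMap.mk₂ ℂ (fun x y => (x.1 * y.1).trace)
    (by intros; simp [Matrix.add_mul]) (by intros; simp)
    (by intros; simp [Matrix.mul_add]) (by intros; simp)
  have hB : LinearMap.IsSymm B := ⟨fun x y => Matrix.trace_mul_comm x.1 y.1⟩
  have : Invertible (2 : ℂ) := invertibleOfNonzero two_ne_zero
  obtain ⟨v, hv⟩ := LinearMap.BilinForm.exists_orthogonal_basis hB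
  let w := v.reindex (finCongr hdim)
  have hw : ∀ i j, i ≠ j → ((w i).1 * (w j).1).trace = 0 := by
    intro i j hij
    have := hv (show (finCongr hdim).symm i ≠ (finCongr hdim).symm j by simpa using hij)
    rw [Function.onFun] at this
    simpa [w, B] using this
  -- An isotropic vector of an orthogonal basis would lie in the radical. So every vector can be
  -- normalised by a complex square root.
  have hne : ∀ i, ((w i).1 * (w i).1).trace ≠ 0 := by
    intro i hi
    have h0 : B (w i) = 0 := by
      refine w.ext fun j => ?_
      by_cases hij : i = j
      · subst hij; exact hi
      · exact hw i j hij
    refine w.ne_zero i (Subtype.ext (Matrix.eq_zero_of_trace_mul_traceless hN (hV _) ?_))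
    intro M hM
    exact congrArg (fun f => f (⟨M, hM⟩ : V)) h0
  choose c hc using fun i => IsAlgClosed.exists_pow_nat_eq ((w i).1 * (w i).1).trace two_pos
  have hc0 : ∀ i, c i ≠ 0 := fun i h => hne i (by rw [← hc i, h]; simp)
  refine ⟨fun i => (c i)⁻¹ • (w i).1, ⟨fun i => ?_, fun i j => ?_⟩⟩
  · rw [Matrix.trace_smul, hV, smul_zero]
  · rw [Matrix.smul_mul, Matrix.mul_smul, Matrix.trace_smul, Matrix.trace_smul]
    split_ifs with h
    · subst h
      rw [← hc i]
      have := hc0 i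
      simp only [smul_eq_mul]
      field_simp
    · rw [hw i j h, smul_zero, smul_zero]

end OrthonormalBasis

/-! ### Vanishing and divisibility of integral Laurent polynomials -/

namespace LaurentPolynomial

theorem eq_zero_of_eval₂_natCast (R : ℤ[T;T⁻¹]) (h : ∀ (N : ℕ) (hN : (N : ℂ) ≠ 0),
    eval₂ (Int.castRingHom ℂ) (Units.mk0 (N : ℂ) hN) R = 0) : R = 0 := by
  obtain ⟨n, p, hp⟩ := exists_T_pow R
  have hp0 : p.map (Int.castRingHom ℂ) = 0 := by
    refine Polynomial.eq_zero_of_infinite_isRoot _ (Set.Infinite.mono (s := Set.range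
      fun N : ℕ => ((N + 1 : ℕ) : ℂ)) ?_ (Set.infinite_range_of_injective fun a b hab => ?_))
    · rintro _ ⟨N, rfl⟩
      have hN : ((N + 1 : ℕ) : ℂ) ≠ 0 := Nat.cast_ne_zero.2 N.succ_ne_zero
      have := congrArg (eval₂ (Int.castRingHom ℂ) (Units.mk0 _ hN)) hp
      rw [eval₂_toLaurent, map_mul, h, zero_mul] at this
      rwa [Set.mem_ofPred_eq, Polynomial.IsRoot.def, Polynomial.eval_map]
    · simpa using hab
  rw [Polynomial.map_eq_zero_iff (RingHom.injective_int _)] at hp0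
  rw [hp0, map_zero] at hp
  exact ((isUnit_T n).mul_left_eq_zero).1 hp.symm

theorem T_two_sub_one_dvd (R : ℤ[T;T⁻¹]) (h1 : eval₂ (Int.castRingHom ℂ) 1 R = 0)
    (h2 : eval₂ (Int.castRingHom ℂ) (-1) R = 0) : T 2 - 1 ∣ R := by
  obtain ⟨n, p, hp⟩ := exists_T_pow R
  have key : ∀ x : ℤˣ, eval₂ (Int.castRingHom ℂ) (Units.map (Int.castRingHom ℂ).toMonoidHom x) R = 0 →
      p.IsRoot x := by
    intro x hx
    have := congrArg (eval₂ (Int.castRingHom ℂ) (Units.map (Int.castRingHom ℂ).toMonoidHom x)) hp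
    rw [eval₂_toLaurent, map_mul, hx, zero_mul] at this
    change Polynomial.eval₂ (Int.castRingHom ℂ) ((Int.castRingHom ℂ) x) p = 0 at this
    rw [Polynomial.eval₂_at_apply] at this
    exact (map_eq_zero_iff _ (RingHom.injective_int _)).1 this
  have r1 : p.IsRoot 1 := key 1 (by rwa [map_one])
  have r2 : p.IsRoot (-1) := key (-1) (by
    rwa [show Units.map (Int.castRingHom ℂ).toMonoidHom (-1) = -1 from Units.ext (by simp)])
  obtain ⟨q, rfl⟩ := Polynomial.dvd_iff_isRoot.2 r1
  have r3 : q.IsRoot (-1) := by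
    rw [Polynomial.IsRoot.def, Polynomial.eval_mul] at r2
    refine (mul_eq_zero.1 r2).resolve_left ?_
    simp
  obtain ⟨s, rfl⟩ := Polynomial.dvd_iff_isRoot.2 r3
  have hR : R = Polynomial.toLaurent ((Polynomial.X - Polynomial.C 1) *
      ((Polynomial.X - Polynomial.C (-1)) * s)) * T (-n) := by
    rw [hp, mul_T_assoc, add_neg_cancel, T_zero, mul_one]
  refine ⟨Polynomial.toLaurent s * T (-n), ?_⟩
  rw [hR, ← mul_assoc, ← mul_assoc]
  congr 2
  rw [map_mul]
  congr 1
  rw [map_mul, ← sub_eq_zero]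
  simp only [map_sub, Polynomial.toLaurent_X, map_one, map_neg]
  rw [show (2 : ℤ) = 1 + 1 by rfl, T_add]
  ring

end LaurentPolynomial

/-! ### Contracting fundamental vertices along a matching -/

section TensorSum

open Equiv.Perm

variable {N : ℕ} {E H : Type*} [Fintype H] [DecidableEq E]

open Classical in
theorem IsOrthonormalBasisSl.sum_prod_matching [Fintype E] {T : Fin (N ^ 2 - 1) → Matrix (Fin N) (Fin N) ℂ}
    (hT : IsOrthonormalBasisSl T) (hN : N ≠ 0) (π : Equiv.Perm H) (m : E × Bool ≃ H)
    (hm : ∀ e b, π (m (e, b)) = m (e, !b)) (y z : H → Fin N)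
    [Fintype {i : H → Fin (N ^ 2 - 1) // ∀ h, i (π h) = i h}] :
    ∑ i : {i : H → Fin (N ^ 2 - 1) // ∀ h, i (π h) = i h}, ∏ h, T (i.1 h) (y h) (z h) =
      ∑ S : Finset E, if ∀ h, y h = z (flipOn m S h) then (-(N : ℂ)⁻¹) ^ Sᶜ.card else 0 := by
  let lab : {i : H → Fin (N ^ 2 - 1) // ∀ h, i (π h) = i h} ≃ (E → Fin (N ^ 2 - 1)) :=
    { toFun := fun i e => i.1 (m (e, true))
      invFun := fun j => ⟨fun h => j (m.symm h).1, fun h => by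
        obtain ⟨⟨e, b⟩, rfl⟩ := m.surjective h
        rw [hm]
        simp⟩
      left_inv := fun i => by
        ext h
        obtain ⟨⟨e, b⟩, rfl⟩ := m.surjective h
        cases b
        · have := i.2 (m (e, true))
          rw [hm] at this
          simpa using congrArg Fin.val this.symm
        · simp
      right_inv := fun j => by ext; simp }
  calc _ = ∑ j : E → Fin (N ^ 2 - 1), ∏ e, (T (j e) (y (m (e, true))) (z (m (e, true))) *
          T (j e) (y (m (e, false))) (z (m (e, false)))) := by
        rw [← lab.symm.sum_comp]
        refine Finset.sum_congr rfl fun j _ => ?_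
        rw [← m.prod_comp, Fintype.prod_prod_type]
        refine Finset.prod_congr rfl fun e _ => ?_
        rw [Fintype.prod_bool]
        simp [lab]
    _ = ∏ e, ((if y (m (e, true)) = z (m (e, false)) ∧ z (m (e, true)) = y (m (e, false))
            then 1 else 0) +
          (if y (m (e, true)) = z (m (e, true)) ∧ y (m (e, false)) = z (m (e, false))
            then -(N : ℂ)⁻¹ else 0)) := by
        let f : E → Fin (N ^ 2 - 1) → ℂ := fun e l =>
          T l (y (m (e, true))) (z (m (e, true))) * T l (y (m (e, false))) (z (m (e, false)))
        have hf := Finset.prod_univ_sum (fun _ => Finset.univ) f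
        rw [Fintype.piFinset_univ] at hf
        refine hf.symm.trans ?_
        exact Finset.prod_congr rfl fun e _ => hT.sum_mul_apply hN _ _ _ _
    _ = _ := by
        -- In the expanded product, `S` collects the edges which contribute the double line term.
        rw [Finset.prod_add, Finset.powerset_univ]
        refine Finset.sum_congr rfl fun S _ => ?_
        rw [Finset.prod_ite_zero, Finset.prod_ite_zero, Finset.prod_const_one, Finset.prod_const,
          ← Finset.compl_eq_univ_sdiff, ite_zero_mul_ite_zero, one_mul]
        have hiff : ((∀ e ∈ S, y (m (e, true)) = z (m (e, false)) ∧
            z (m (e, true)) = y (m (e, false))) ∧ ∀ e ∈ Sᶜ, y (m (e, true)) = z (m (e, true)) ∧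
            y (m (e, false)) = z (m (e, false))) ↔ ∀ h, y h = z (flipOn m S h) := by
          refine ⟨?_, ?_⟩
          · rintro ⟨h1, h2⟩ h
            obtain ⟨⟨e, b⟩, rfl⟩ := m.surjective h
            rw [flipOn_apply]
            by_cases he : e ∈ S
            · cases b
              · simpa [he] using (h1 e he).2.symm
              · simpa [he] using (h1 e he).1
            · cases b
              · simpa [he] using (h2 e (by simpa using he)).2
              · simpa [he] using (h2 e (by simpa using he)).1
          · intro h
            have key : ∀ e b, y (m (e, b)) = z (m (e, if e ∈ S then !b else b)) := fun e b => by
              rw [h, flipOn_apply]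
            refine ⟨fun e he => ?_, fun e he => ?_⟩
            · exact ⟨by simp [key, he], by simp [key, he]⟩
            · have he' : e ∉ S := by simpa using he
              exact ⟨by simp [key, he'], by simp [key, he']⟩
        by_cases hy : ∀ h, y h = z (flipOn m S h)
        · rw [if_pos hy, if_pos (hiff.2 hy)]
        · rw [if_neg hy, if_neg (mt hiff.1 hy)]

/-- After substituting `σ h` for `h`, the condition says that `x` is constant on the orbits of
`flipOn m S * σ`: one free index per face. -/
theorem card_flipOn_invariant (m : E × Bool ≃ H) (S : Finset E) (σ : Equiv.Perm H) :
    Nat.card {x : H → Fin N // ∀ h, x (σ.symm h) = x (flipOn m S h)} =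
      N ^ (flipOn m S * σ).cycleCount := by
  have h := card_invariant (Fin N) (flipOn m S * σ)
  rw [Nat.card_eq_fintype_card (α := Fin N), Fintype.card_fin] at h
  rw [← h]
  refine Nat.card_congr (Equiv.subtypeEquivRight fun x => ?_)
  rw [← σ.forall_congr_right (q := fun h => x (σ.symm h) = x (flipOn m S h))]
  simp only [Equiv.symm_apply_apply, mul_apply, eq_comm]

/-- The contraction of a permutation of fundamental vertices. -/
theorem IsOrthonormalBasisSl.sum_prod_perm [Fintype E] {T : Fin (N ^ 2 - 1) → Matrix (Fin N) (Fin N) ℂ}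
    (hT : IsOrthonormalBasisSl T) (hN : N ≠ 0) (π : Equiv.Perm H) (m : E × Bool ≃ H)
    (hm : ∀ e b, π (m (e, b)) = m (e, !b)) (σ : Equiv.Perm H) [DecidableEq H]
    [Fintype {i : H → Fin (N ^ 2 - 1) // ∀ h, i (π h) = i h}] :
    ∑ i : {i : H → Fin (N ^ 2 - 1) // ∀ h, i (π h) = i h}, ∑ x : H → Fin N,
        ∏ h, T (i.1 h) (x (σ.symm h)) (x h) =
      ∑ S : Finset E, (-(N : ℂ)⁻¹) ^ Sᶜ.card * (N : ℂ) ^ (flipOn m S * σ).cycleCount := by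
  classical
  rw [Finset.sum_comm]
  simp only [hT.sum_prod_matching hN π m hm]
  rw [Finset.sum_comm]
  refine Finset.sum_congr rfl fun S _ => ?_
  rw [← Finset.sum_filter, Finset.sum_const, nsmul_eq_mul, mul_comm, ← Nat.cast_pow,
    ← card_flipOn_invariant, Nat.card_eq_fintype_card, Fintype.card_subtype]

end TensorSum

/-! ### Structure constants as signed cyclic orders -/

/-- The two cyclic orders of three elements. -/
def cyclicTurn (b : Bool) : Equiv.Perm (Fin 3) := Equiv.addRight (if b then 1 else -1)

theorem cyclicTurn_symm_true (k : Fin 3) : (cyclicTurn true).symm k = k - 1 := by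
  revert k; decide

theorem cyclicTurn_symm_false (k : Fin 3) : (cyclicTurn false).symm k = k + 1 := by
  revert k; decide

theorem sign_cyclicTurn (b : Bool) : Equiv.Perm.sign (cyclicTurn b) = 1 := by
  revert b; decide

/-- The sign with which a cyclic order contributes to a structure constant. -/
def orientationSign (b : Bool) : ℤ := if b then 1 else -1

theorem sum_fin_three_arrow {X M : Type*} [Fintype X] [AddCommMonoid M] (f : (Fin 3 → X) → M) :
    ∑ x, f x = ∑ a, ∑ b, ∑ c, f ![a, b, c] := by
  let e : X × X × X ≃ (Fin 3 → X) :=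
    { toFun := fun p => ![p.1, p.2.1, p.2.2]
      invFun := fun x => (x 0, x 1, x 2)
      left_inv := fun p => rfl
      right_inv := fun x => by ext k; fin_cases k <;> rfl }
  rw [← e.sum_comp, Fintype.sum_prod_type]
  exact Finset.sum_congr rfl fun a _ => Fintype.sum_prod_type _

theorem structureConstant_eq_sum {N : ℕ} (T : Fin (N ^ 2 - 1) → Matrix (Fin N) (Fin N) ℂ)
    (l : Fin 3 → Fin (N ^ 2 - 1)) :
    structureConstant T (l 0) (l 1) (l 2) = ∑ b, (orientationSign b : ℂ) *
      ∑ x : Fin 3 → Fin N, ∏ k, T (l k) (x ((cyclicTurn b).symm k)) (x k) := by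
  have h1 : (T (l 0) * T (l 1) * T (l 2)).trace =
      ∑ x : Fin 3 → Fin N, ∏ k, T (l k) (x ((cyclicTurn true).symm k)) (x k) := by
    simp only [sum_fin_three_arrow, Fin.prod_univ_three, cyclicTurn_symm_true]
    change _ = ∑ a, ∑ b, ∑ c, T (l 0) c a * T (l 1) a b * T (l 2) b c
    simp only [Matrix.trace, Matrix.diag_apply, Matrix.mul_apply, Finset.sum_mul]
    conv_rhs => rw [Finset.sum_comm]
    conv_rhs => enter [2, b]; rw [Finset.sum_comm]
    conv_rhs => rw [Finset.sum_comm]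
  have h2 : (T (l 1) * T (l 0) * T (l 2)).trace =
      ∑ x : Fin 3 → Fin N, ∏ k, T (l k) (x ((cyclicTurn false).symm k)) (x k) := by
    simp only [sum_fin_three_arrow, Fin.prod_univ_three, cyclicTurn_symm_false]
    change _ = ∑ a, ∑ b, ∑ c, T (l 0) b a * T (l 1) c b * T (l 2) a c
    simp only [Matrix.trace, Matrix.diag_apply, Matrix.mul_apply, Finset.sum_mul]
    conv_rhs => enter [2, a]; rw [Finset.sum_comm]
    conv_rhs => rw [Finset.sum_comm]
    simp only [mul_comm (T (l 0) _ _)]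
  rw [structureConstant, Matrix.sub_mul, Matrix.trace_sub, h1, h2, Fintype.sum_bool]
  simp [orientationSign, sub_eq_add_neg]

/-! ### Reversing a triangle at a deleted edge -/

section Bypass

variable {H X : Type*} [Finite H] [Finite X] {s s' ρ : H → H} {h₀ h₁ h₂ : H}

/-- As `ρ` fixes `h₀`, the half-edge `h₀` carries an identity matrix: it can be taken out of one
arrow of the triangle and inserted into another. The new label at `h₀` is that of `h₁`; the old one
is recovered as that of `h₂`. -/
theorem card_invariant_le_of_bypass (n1 : h₁ ≠ h₀) (n2 : h₂ ≠ h₀) (s0 : s h₀ = h₂)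
    (s1 : s h₁ = h₀) (s2 : s h₂ = h₁) (t0 : s' h₀ = h₁) (t1 : s' h₁ = h₂) (t2 : s' h₂ = h₀)
    (hs : ∀ h, h ≠ h₀ → h ≠ h₁ → h ≠ h₂ → s' h = s h ∧ s h ≠ h₀) (r0 : ρ h₀ = h₀)
    (hr : ∀ h, h ≠ h₀ → ρ h ≠ h₀) :
    Nat.card {x : H → X // ∀ h, x (s h) = x (ρ h)} ≤
      Nat.card {x : H → X // ∀ h, x (s' h) = x (ρ h)} := by
  classical
  have hx0 : ∀ x : {x : H → X // ∀ h, x (s h) = x (ρ h)}, x.1 h₂ = x.1 h₀ := fun x => by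
    have := x.2 h₀
    rwa [s0, r0] at this
  refine Nat.card_le_card_of_injective (fun x => ⟨Function.update x.1 h₀ (x.1 h₁), fun h => ?_⟩) ?_
  · by_cases c0 : h = h₀
    · subst c0
      rw [t0, r0, Function.update_of_ne n1, Function.update_self]
    rw [Function.update_of_ne (hr h c0), ← x.2 h]
    by_cases c1 : h = h₁
    · subst c1
      rw [t1, s1, Function.update_of_ne n2, hx0]
    by_cases c2 : h = h₂
    · subst c2
      rw [t2, s2, Function.update_self]
    rw [(hs h c0 c1 c2).1, Function.update_of_ne (hs h c0 c1 c2).2]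
  · intro x y hxy
    have hxy' := fun h => congrFun (Subtype.mk.inj hxy) h
    have hne : ∀ h, h ≠ h₀ → x.1 h = y.1 h := fun h hh => by
      have := hxy' h
      rwa [Function.update_of_ne hh, Function.update_of_ne hh] at this
    ext h
    by_cases c0 : h = h₀
    · rw [c0, ← hx0, ← hx0, hne _ n2]
    · exact hne h c0

/-- Moving a half-edge whose label is not constrained elsewhere from one arrow of an oriented
triangle to another preserves the number of labelings. -/
theorem card_invariant_eq_of_bypass (n1 : h₁ ≠ h₀) (n2 : h₂ ≠ h₀) (s0 : s h₀ = h₂)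
    (s1 : s h₁ = h₀) (s2 : s h₂ = h₁) (t0 : s' h₀ = h₁) (t1 : s' h₁ = h₂) (t2 : s' h₂ = h₀)
    (hs : ∀ h, h ≠ h₀ → h ≠ h₁ → h ≠ h₂ → s' h = s h ∧ s h ≠ h₀) (r0 : ρ h₀ = h₀)
    (hr : ∀ h, h ≠ h₀ → ρ h ≠ h₀) :
    Nat.card {x : H → X // ∀ h, x (s h) = x (ρ h)} =
      Nat.card {x : H → X // ∀ h, x (s' h) = x (ρ h)} :=
  le_antisymm (card_invariant_le_of_bypass n1 n2 s0 s1 s2 t0 t1 t2 hs r0 hr)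
    (card_invariant_le_of_bypass n2 n1 t0 t2 t1 s0 s2 s1
      (fun h c0 c2 c1 => by
        obtain ⟨e, e'⟩ := hs h c0 c1 c2
        exact ⟨e.symm, e ▸ e'⟩) r0 hr)

end Bypass

/-! ### The contraction as a signed sum over cyclic orders -/

namespace ColorGraph

variable {F A : Type*}

/-- The permutation of the half-edges obtained by a choice of a cyclic order at every adjoint
vertex. -/
def orient (G : ColorGraph F A) (ε : A → Bool) : Equiv.Perm (F ⊕ A × Fin 3) :=
  Equiv.sumCongr G.next (Equiv.prodCongrRight fun a => cyclicTurn (ε a))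

@[simp] theorem orient_inr (G : ColorGraph F A) (ε : A → Bool) (a : A) (k : Fin 3) :
    G.orient ε (.inr (a, k)) = .inr (a, cyclicTurn (ε a) k) := rfl

@[simp] theorem orient_symm_inl (G : ColorGraph F A) (ε : A → Bool) (v : F) :
    (G.orient ε).symm (.inl v) = .inl (G.next.symm v) := rfl

@[simp] theorem orient_symm_inr (G : ColorGraph F A) (ε : A → Bool) (a : A) (k : Fin 3) :
    (G.orient ε).symm (.inr (a, k)) = .inr (a, (cyclicTurn (ε a)).symm k) := rfl

open Classical in
theorem contraction_eq_sum_orient [Fintype F] [Fintype A] (G : ColorGraph F A) {N : ℕ}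
    (T : Fin (N ^ 2 - 1) → Matrix (Fin N) (Fin N) ℂ) :
    G.contraction T = ∑ ε : A → Bool, ((∏ a, orientationSign (ε a) : ℤ) : ℂ) *
      ∑ i : {i : F ⊕ A × Fin 3 → Fin (N ^ 2 - 1) // ∀ h, i (G.pair h) = i h},
        ∑ x : F ⊕ A × Fin 3 → Fin N, ∏ h, T (i.1 h) (x ((G.orient ε).symm h)) (x h) := by
  simp only [Finset.mul_sum]
  rw [contraction]
  conv_rhs => rw [Finset.sum_comm]
  refine Finset.sum_congr rfl fun i _ => ?_
  simp only [← Finset.mul_sum]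
  have hadj : ∏ a : A, structureConstant T (i.1 (.inr (a, 0))) (i.1 (.inr (a, 1)))
        (i.1 (.inr (a, 2))) = ∑ ε : A → Bool, ((∏ a, orientationSign (ε a) : ℤ) : ℂ) *
      ∑ y : A → Fin 3 → Fin N, ∏ a, ∏ k,
        T (i.1 (.inr (a, k))) (y a ((cyclicTurn (ε a)).symm k)) (y a k) := by
    have h1 : ∀ a : A, structureConstant T (i.1 (.inr (a, 0))) (i.1 (.inr (a, 1)))
        (i.1 (.inr (a, 2))) = ∑ b, (orientationSign b : ℂ) * ∑ x : Fin 3 → Fin N,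
          ∏ k, T (i.1 (.inr (a, k))) (x ((cyclicTurn b).symm k)) (x k) := fun a =>
      structureConstant_eq_sum T fun k => i.1 (.inr (a, k))
    simp only [h1]
    rw [Finset.prod_univ_sum, Fintype.piFinset_univ]
    refine Finset.sum_congr rfl fun ε _ => ?_
    rw [Finset.prod_mul_distrib, Int.cast_prod]
    congr 1
    have h2 := Finset.prod_univ_sum (fun _ : A => (Finset.univ : Finset (Fin 3 → Fin N)))
      (fun a x => ∏ k, T (i.1 (.inr (a, k))) (x ((cyclicTurn (ε a)).symm k)) (x k))
    rwa [Fintype.piFinset_univ] at h2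
  rw [← Finset.sum_mul, hadj, Finset.mul_sum]
  refine Finset.sum_congr rfl fun ε _ => ?_
  rw [mul_left_comm]
  congr 1
  let e : (F → Fin N) × (A → Fin 3 → Fin N) ≃ (F ⊕ A × Fin 3 → Fin N) :=
    ((Equiv.refl _).prodCongr (Equiv.curry A (Fin 3) (Fin N)).symm).trans
      (Equiv.sumArrowEquivProdArrow F (A × Fin 3) (Fin N)).symm
  rw [← e.sum_comp, Fintype.sum_prod_type, Finset.sum_mul_sum]
  refine Finset.sum_congr rfl fun x _ => Finset.sum_congr rfl fun y _ => ?_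
  rw [Fintype.prod_sum_type, Fintype.prod_prod_type]
  rfl

/-- Two cyclic orders of a triangle differ only by the position of the half-edge `k`, which is
irrelevant when `ρ` leaves it unpaired. -/
theorem card_orient_invariant_eq [Finite F] [Finite A] (G : ColorGraph F A) {X : Type*} [Finite X]
    {ε ε' : A → Bool} {a : A} (ha : ε' a = !ε a) (hε : ∀ b, b ≠ a → ε' b = ε b)
    {ρ : F ⊕ A × Fin 3 → F ⊕ A × Fin 3} (hρ : ∀ h, ρ (ρ h) = h) {k : Fin 3}
    (hk : ρ (.inr (a, k)) = .inr (a, k)) :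
    Nat.card {x : F ⊕ A × Fin 3 → X // ∀ h, x ((G.orient ε).symm h) = x (ρ h)} =
      Nat.card {x : F ⊕ A × Fin 3 → X // ∀ h, x ((G.orient ε').symm h) = x (ρ h)} := by
  have hρk : ∀ h, h ≠ .inr (a, k) → ρ h ≠ .inr (a, k) := fun h hne he => hne <| by
    rw [← hρ h, he, hk]
  have h1 : ∀ k : Fin 3, k + 1 ≠ k := by decide
  have h2 : ∀ k : Fin 3, k - 1 ≠ k := by decide
  have h3 : ∀ k l : Fin 3, l = k ∨ l = k + 1 ∨ l = k - 1 := by decide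
  have h4 : ∀ k : Fin 3, k - 1 - 1 = k + 1 := by decide
  have h5 : ∀ k : Fin 3, k + 1 + 1 = k - 1 := by decide
  have other : ∀ h : F ⊕ A × Fin 3, h ≠ .inr (a, k) → h ≠ .inr (a, k + 1) →
      h ≠ .inr (a, k - 1) → (G.orient ε').symm h = (G.orient ε).symm h ∧
        (G.orient ε).symm h ≠ .inr (a, k) := by
    rintro (v | ⟨b, l⟩) n0 n1 n2
    · simp
    · have hb : b ≠ a := by
        rintro rfl
        rcases h3 k l with rfl | rfl | rfl <;> contradiction
      simp [hε b hb, hb]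
  have e1 : (Sum.inr (a, k + 1) : F ⊕ A × Fin 3) ≠ .inr (a, k) := by simp [h1]
  have e2 : (Sum.inr (a, k - 1) : F ⊕ A × Fin 3) ≠ .inr (a, k) := by simp [h2]
  cases hεa : ε a <;> rw [hεa] at ha
  · refine card_invariant_eq_of_bypass e2 e1 ?_ ?_ ?_ ?_ ?_ ?_
      (fun h n0 n2 n1 => other h n0 n1 n2) hk hρk <;>
      simp [ha, hεa, cyclicTurn_symm_true, cyclicTurn_symm_false, h4, h5]
  · refine card_invariant_eq_of_bypass e1 e2 ?_ ?_ ?_ ?_ ?_ ?_ other hk hρk <;>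
      simp [ha, hεa, cyclicTurn_symm_true, cyclicTurn_symm_false, h4, h5]

end ColorGraph

/-! ### The double line expansion, uniqueness and parity -/

namespace ColorGraph

open Equiv.Perm

variable {F A E : Type*} [Fintype F] [Fintype A]

/-- The edges outside of `S` join fundamental vertices only. -/
def IsAdmissible (m : E × Bool ≃ F ⊕ A × Fin 3) (S : Finset E) : Prop :=
  ∀ e ∉ S, ∀ b, (m (e, b)).isLeft

-- The identity matrix is central, so a structure constant vanishes when it is inserted.
-- Combinatorially, reversing the order at an adjoint vertex on a deleted edge keeps the number of
-- faces and changes the sign.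
open Classical in
theorem sum_orientationSign_mul_eq_zero (G : ColorGraph F A) (m : E × Bool ≃ F ⊕ A × Fin 3)
    {S : Finset E} (hS : ¬ IsAdmissible m S) (N : ℕ) :
    ∑ ε : A → Bool, ((∏ a, orientationSign (ε a) : ℤ) : ℂ) *
      (N : ℂ) ^ (flipOn m S * G.orient ε).cycleCount = 0 := by
  simp only [IsAdmissible, not_forall] at hS
  obtain ⟨e, he, b, hb⟩ := hS
  obtain ⟨⟨a, k⟩, hak⟩ : ∃ p, m (e, b) = .inr p := by
    rcases h : m (e, b) with v | p
    · exact absurd (by rw [h]; rfl) hb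
    · exact ⟨p, rfl⟩
  have hfix : flipOn m S (.inr (a, k)) = .inr (a, k) := by
    rw [← hak, flipOn_apply, if_neg he]
  refine Finset.sum_involution (fun ε _ => Function.update ε a (!ε a)) ?_ ?_ ?_ ?_
  · intro ε _
    have h1 : (flipOn m S * G.orient (Function.update ε a (!ε a))).cycleCount =
        (flipOn m S * G.orient ε).cycleCount := by
      -- With two labels, the number of labelings `2 ^ c` determines the number of orbits `c`.
      have h := G.card_orient_invariant_eq (X := Fin 2) (ε := ε)
        (ε' := Function.update ε a (!ε a)) (Function.update_self ..)
        (fun b hb => Function.update_of_ne hb ..) (flipOn_flipOn m S) hfix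
      rw [card_flipOn_invariant, card_flipOn_invariant] at h
      exact (Nat.pow_right_injective le_rfl h).symm
    have h2 : ∏ c, orientationSign (Function.update ε a (!ε a) c) =
        -∏ c, orientationSign (ε c) := by
      rw [← Finset.mul_prod_erase _ _ (Finset.mem_univ a),
        ← Finset.mul_prod_erase _ (fun c => orientationSign (ε c)) (Finset.mem_univ a),
        Function.update_self, ← neg_mul]
      congr 1
      · cases ε a <;> rfl
      · refine Finset.prod_congr rfl fun c hc => ?_
        rw [Function.update_of_ne (Finset.ne_of_mem_erase hc)]
    rw [h1, h2, Int.cast_neg]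
    ring
  · intro ε _ _ h
    have := congrFun h a
    rw [Function.update_self] at this
    revert this
    cases ε a <;> decide
  · exact fun _ _ => Finset.mem_univ _
  · intro ε _
    ext c
    by_cases hc : c = a
    · subst hc; simp
    · simp [hc]

variable [Fintype E]

open Classical in
/-- The double line expansion of the color factor. -/
noncomputable def colorPolynomial (G : ColorGraph F A) (m : E × Bool ≃ F ⊕ A × Fin 3) : ℤ[T;T⁻¹] :=
  ∑ ε : A → Bool, ∑ S : Finset E with IsAdmissible m S,
    LaurentPolynomial.C ((∏ a, orientationSign (ε a)) * (-1) ^ Sᶜ.card) *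
      LaurentPolynomial.T (((flipOn m S * G.orient ε).cycleCount : ℤ) - (Sᶜ.card : ℤ))

theorem isColorFactor_colorPolynomial (G : ColorGraph F A) (m : E × Bool ≃ F ⊕ A × Fin 3)
    (hm : ∀ e b, G.pair (m (e, b)) = m (e, !b)) : G.IsColorFactor (G.colorPolynomial m) := by
  classical
  intro N hN T hT
  have hN0 : N ≠ 0 := by exact_mod_cast hN
  rw [contraction_eq_sum_orient]
  simp only [hT.sum_prod_perm hN0 G.pair m hm, colorPolynomial, map_sum, Finset.mul_sum]
  rw [Finset.sum_comm]
  conv_rhs => rw [Finset.sum_comm]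
  rw [Finset.sum_filter]
  refine Finset.sum_congr rfl fun S _ => ?_
  split_ifs with hS
  · refine Finset.sum_congr rfl fun ε _ => ?_
    rw [LaurentPolynomial.eval₂_C_mul_T, Units.val_zpow_eq_zpow_val, Units.val_mk0,
      zpow_sub₀ hN, zpow_natCast, zpow_natCast, neg_pow (N : ℂ)⁻¹]
    simp only [eq_intCast, Int.cast_mul, Int.cast_pow, Int.cast_neg, Int.cast_one, inv_pow]
    ring
  · have h := G.sum_orientationSign_mul_eq_zero m hS N
    simp only [mul_left_comm _ ((-(N : ℂ)⁻¹) ^ Sᶜ.card)]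
    rw [← Finset.mul_sum, h, mul_zero]

theorem IsColorFactor.eq {G : ColorGraph F A} {R R' : ℤ[T;T⁻¹]} (hR : G.IsColorFactor R)
    (hR' : G.IsColorFactor R') : R = R' := by
  rw [← sub_eq_zero]
  refine LaurentPolynomial.eq_zero_of_eval₂_natCast _ fun N hN => ?_
  obtain ⟨T, hT⟩ := exists_isOrthonormalBasisSl (N := N) (by exact_mod_cast hN)
  rw [map_sub, hR N hN T hT, hR' N hN T hT, sub_self]

theorem IsColorFactor.eq_zero {G : ColorGraph F A} {R : ℤ[T;T⁻¹]} (hR : G.IsColorFactor R)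
    (h : ∀ (N : ℕ) (T : Fin (N ^ 2 - 1) → Matrix (Fin N) (Fin N) ℂ), G.contraction T = 0) :
    R = 0 :=
  hR.eq fun N hN T _ => by rw [map_zero, h]

theorem IsColorFactor.eval₂_one [Nonempty (F ⊕ A)] {G : ColorGraph F A} {R : ℤ[T;T⁻¹]}
    (hR : G.IsColorFactor R) : LaurentPolynomial.eval₂ (Int.castRingHom ℂ) 1 R = 0 := by
  have h1 : ((1 : ℕ) : ℂ) ≠ 0 := by simp
  obtain ⟨T, hT⟩ := exists_isOrthonormalBasisSl (N := 1) one_ne_zero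
  have h := hR 1 h1 T hT
  rw [show Units.mk0 ((1 : ℕ) : ℂ) h1 = 1 from Units.ext (by simp)] at h
  rw [h, contraction]
  -- `sl(1)` is zero and every vertex has a non-oriented half-edge, so no labeling exists.
  have : IsEmpty {i : F ⊕ A × Fin 3 → Fin (1 ^ 2 - 1) // ∀ h, i (G.pair h) = i h} := by
    refine ⟨fun i => ?_⟩
    rcases ‹Nonempty (F ⊕ A)› with ⟨v | a⟩
    · exact (i.1 (.inl v)).elim0
    · exact (i.1 (.inr (a, 0))).elim0
  exact Finset.sum_of_isEmpty _

/-- Compare signs: the triangles are even, so `G.orient ε` has the sign of `G.next`, and flipping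
`S` contributes `(-1) ^ |S|`. The number of half-edges is even and drops out. -/
theorem neg_one_pow_cycleCount [DecidableEq E] (G : ColorGraph F A) (m : E × Bool ≃ F ⊕ A × Fin 3)
    (S : Finset E) (ε : A → Bool) :
    (-1 : ℤˣ) ^ ((flipOn m S * G.orient ε).cycleCount + Sᶜ.card) =
      (-1) ^ (G.numOrientedCycles + (Fintype.card F + Fintype.card E)) := by
  classical
  have h1 : sign (G.orient ε) = sign G.next := by
    rw [orient, sign_sumCongr, sign_prodCongrRight]
    simp [sign_cyclicTurn]
  have h2 := sign_eq_neg_one_pow_cycleCount (flipOn m S * G.orient ε)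
  rw [Equiv.Perm.sign_mul, sign_flipOn, h1, sign_eq_neg_one_pow_cycleCount, ← pow_add] at h2
  have h3 : Fintype.card (F ⊕ A × Fin 3) = Fintype.card E * 2 := by
    rw [← Fintype.card_congr m]; simp
  have h4 := Finset.card_add_card_compl S
  rw [h3, pow_add _ (_ * 2), mul_comm _ 2, pow_mul, neg_one_sq, one_pow, one_mul] at h2
  rw [← h4, pow_add, ← h2, ← pow_add]
  change _ = (-1 : ℤˣ) ^ (G.next.cycleCount + _)
  rw [show S.card + (Fintype.card F + G.next.cycleCount) + Sᶜ.card =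
    G.next.cycleCount + (Fintype.card F + (S.card + Sᶜ.card)) by ring]

theorem substNeg_C_mul_T (r n : ℤ) : substNeg (LaurentPolynomial.C r * LaurentPolynomial.T n) =
    LaurentPolynomial.C (((-1 : ℤˣ) ^ n : ℤˣ) * r) * LaurentPolynomial.T n := by
  have h : (-laurentVar) = Units.map (LaurentPolynomial.C (R := ℤ)).toMonoidHom (-1) * laurentVar :=
    Units.ext (by simp)
  have hT : ((laurentVar ^ n : ℤ[T;T⁻¹]ˣ) : ℤ[T;T⁻¹]) = LaurentPolynomial.T n := by
    induction n using Int.induction_on with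
    | zero => simp
    | succ n ih =>
      rw [zpow_add_one, Units.val_mul, ih, LaurentPolynomial.T_add]
      rfl
    | pred n ih =>
      rw [zpow_sub_one, Units.val_mul, ih, sub_eq_add_neg, LaurentPolynomial.T_add]
      rfl
  rw [substNeg, LaurentPolynomial.eval₂_C_mul_T, h, mul_zpow, ← map_zpow, Units.val_mul, hT,
    map_mul, mul_left_comm, mul_assoc]
  rfl

theorem substNeg_colorPolynomial (G : ColorGraph F A) (m : E × Bool ≃ F ⊕ A × Fin 3) :
    substNeg (G.colorPolynomial m) =
      (-1) ^ (G.numOrientedCycles + (Fintype.card F + Fintype.card E)) * G.colorPolynomial m := by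
  classical
  simp only [colorPolynomial, map_sum, Finset.mul_sum]
  refine Finset.sum_congr rfl fun ε _ => Finset.sum_congr rfl fun S _ => ?_
  rw [substNeg_C_mul_T]
  have h : (-1 : ℤˣ) ^ (((flipOn m S * G.orient ε).cycleCount : ℤ) - (Sᶜ.card : ℤ)) =
      (-1) ^ (G.numOrientedCycles + (Fintype.card F + Fintype.card E)) := by
    rw [← neg_one_pow_cycleCount G m S ε, zpow_sub, zpow_natCast, zpow_natCast, pow_add]
    congr 1
  rw [h, map_mul, ← mul_assoc]
  simp

theorem eval₂_neg_one_eq (R : ℤ[T;T⁻¹]) : LaurentPolynomial.eval₂ (Int.castRingHom ℂ) (-1) R =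
    LaurentPolynomial.eval₂ (Int.castRingHom ℂ) 1 (substNeg R) := by
  induction R using LaurentPolynomial.induction_on' with
  | add p q hp hq => simp only [map_add, hp, hq]
  | C_mul_T n r =>
    rw [substNeg_C_mul_T, LaurentPolynomial.eval₂_C_mul_T, LaurentPolynomial.eval₂_C_mul_T]
    rcases Int.even_or_odd n with h | h <;> simp [h.neg_one_zpow]

end ColorGraph

/-! ### The cycle space and the bounds on exponents -/

namespace ColorGraph

open Equiv.Perm

variable {F A E : Type*}

/-- The boundary of a flow on the half-edges. -/
def flowBoundary (G : ColorGraph F A) :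
    ((F → ℚ) × (F ⊕ A × Fin 3 → ℚ)) →ₗ[ℚ] (F ⊕ A → ℚ) where
  toFun c := Sum.elim (fun v => c.1 v - c.1 (G.next.symm v) + c.2 (.inl v))
    fun a => ∑ k : Fin 3, c.2 (.inr (a, k))
  map_add' c d := by
    ext (v | a)
    · simp; ring
    · simp [Finset.sum_add_distrib]
  map_smul' r c := by
    ext (v | a)
    · simp; ring
    · simp [Finset.mul_sum]

/-- The flow on the half-edges given by a flow on the edges. -/
def edgeFlow (m : E × Bool ≃ F ⊕ A × Fin 3) :
    ((F → ℚ) × (E → ℚ)) →ₗ[ℚ] (F → ℚ) × (F ⊕ A × Fin 3 → ℚ) where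
  toFun c := (c.1, fun h => (if (m.symm h).2 then 1 else -1) * c.2 (m.symm h).1)
  map_add' c d := by
    ext
    · simp
    · simp [mul_add]
  map_smul' r c := by
    ext
    · simp
    · simp [mul_left_comm]

theorem edgeFlow_injective (m : E × Bool ≃ F ⊕ A × Fin 3) : Function.Injective (edgeFlow m) := by
  intro c d h
  have h1 : c.1 = d.1 := congrArg (fun x => x.1) h
  have h2 : c.2 = d.2 := by
    ext e
    have := congrFun (congrArg (fun x => x.2) h) (m (e, true))
    simpa [edgeFlow] using this
  exact Prod.ext h1 h2

theorem sum_flowBoundary_edgeFlow [Fintype F] [Fintype A] [Fintype E] (G : ColorGraph F A) (m : E × Bool ≃ F ⊕ A × Fin 3)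
    (c : (F → ℚ) × (E → ℚ)) : ∑ v, G.flowBoundary (edgeFlow m c) v = 0 := by
  have h1 : ∑ h, (edgeFlow m c).2 h = 0 := by
    rw [← m.sum_comp, Fintype.sum_prod_type]
    refine Finset.sum_eq_zero fun e _ => ?_
    rw [Fintype.sum_bool]
    simp [edgeFlow]
  rw [Fintype.sum_sum_type, Fintype.sum_prod_type] at h1
  rw [Fintype.sum_sum_type]
  simp only [flowBoundary, LinearMap.coe_mk, AddHom.coe_mk, Sum.elim_inl, Sum.elim_inr,
    Finset.sum_add_distrib, Finset.sum_sub_distrib]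
  rw [Equiv.sum_comp G.next.symm, sub_self, zero_add, h1]

/-- Rank-nullity for the boundary map on edge flows: its values have total sum zero, so it is not
onto and its rank is less than the number of vertices. The `|F|` oriented edges cancel against the
fundamental vertices. -/
theorem card_edges_lt_loopNumber_add [Fintype F] [Fintype A] [Fintype E] [Nonempty (F ⊕ A)] (G : ColorGraph F A)
    (m : E × Bool ≃ F ⊕ A × Fin 3) (hm : ∀ e b, G.pair (m (e, b)) = m (e, !b)) :
    Fintype.card E < G.loopNumber + Fintype.card A := by
  let D := G.flowBoundary ∘ₗ edgeFlow m
  have hrange : LinearMap.range D ≠ ⊤ := by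
    intro h
    obtain ⟨c, hc⟩ := LinearMap.range_eq_top.1 h fun _ => 1
    have h0 := G.sum_flowBoundary_edgeFlow m c
    change ∑ v, D c v = 0 at h0
    simp only [hc, Finset.sum_const, nsmul_eq_mul, mul_one, Nat.cast_eq_zero,
      Finset.card_univ] at h0
    exact Fintype.card_ne_zero h0
  have h1 := Submodule.finrank_lt hrange
  have h2 := LinearMap.finrank_range_add_finrank_ker D
  have h3 : Module.finrank ℚ (LinearMap.ker D) ≤ G.loopNumber := by
    refine LinearMap.finrank_le_finrank_of_injective (f := ((edgeFlow m).domRestrict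
      (LinearMap.ker D)).codRestrict G.cycleSpace ?_) ?_
    · rintro ⟨c, hc⟩
      have hc' : ∀ v, G.flowBoundary (edgeFlow m c) v = 0 := fun v => congrFun hc v
      refine ⟨fun h => ?_, fun v => hc' (.inl v), fun a => hc' (.inr a)⟩
      obtain ⟨⟨e, b⟩, rfl⟩ := m.surjective h
      rw [hm]
      cases b <;> simp [edgeFlow]
    · intro c d h
      exact Subtype.ext (edgeFlow_injective m (congrArg Subtype.val h))
  simp only [Module.finrank_prod, Module.finrank_fintype_fun_eq_card, Fintype.card_sum] at h1 h2
  omega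

theorem card_halfEdges [Fintype F] [Fintype A] [Fintype E] (m : E × Bool ≃ F ⊕ A × Fin 3) :
    2 * Fintype.card E = Fintype.card F + 3 * Fintype.card A := by
  have := Fintype.card_congr m
  simp only [Fintype.card_prod, Fintype.card_sum, Fintype.card_bool, Fintype.card_fin] at this
  omega

/-- A fundamental vertex has only one non-oriented half-edge, so the deleted edges have pairwise
distinct end points. -/
theorem IsAdmissible.two_mul_card_compl_le [Fintype F] [Fintype E] [DecidableEq E] {m : E × Bool ≃ F ⊕ A × Fin 3}
    {S : Finset E} (hS : IsAdmissible m S) : 2 * Sᶜ.card ≤ Fintype.card F := by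
  have h : ∀ p : {e // e ∈ Sᶜ} × Bool, ∃ v, m (p.1, p.2) = .inl v := fun p =>
    Sum.isLeft_iff.1 (hS p.1 (Finset.mem_compl.1 p.1.2) p.2)
  choose f hf using h
  have hinj : Function.Injective f := by
    rintro ⟨e, b⟩ ⟨e', b'⟩ h
    have := m.injective ((hf (e, b)).trans ((congrArg Sum.inl h).trans (hf (e', b')).symm))
    rw [Prod.mk.injEq] at this
    exact Prod.ext (Subtype.ext this.1) this.2
  have := Fintype.card_le_of_injective f hinj
  simp only [Fintype.card_prod, Fintype.card_coe, Fintype.card_bool] at this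
  omega

theorem card_le_cycleCount_orient [Finite F] [Fintype A] (G : ColorGraph F A) (ε : A → Bool) :
    Fintype.card A ≤ (G.orient ε).cycleCount := by
  rw [← Nat.card_eq_fintype_card]
  refine Nat.card_le_card_of_injective (fun a => Quotient.mk _ (.inr (a, 0))) fun a b h => ?_
  let g : F ⊕ A × Fin 3 → Option A := Sum.elim (fun _ => none) fun p => some p.1
  have hle : SameCycle.setoid (G.orient ε) ≤ Setoid.ker g := by
    rw [sameCycle_setoid_le_iff]
    rintro (v | ⟨a, k⟩) <;> rfl
  exact Option.some_injective _ (hle (Quotient.exact h))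

theorem card_lt_cycleCount_orient [Finite F] [Fintype A] [Nonempty F] (G : ColorGraph F A) (ε : A → Bool) :
    Fintype.card A < (G.orient ε).cycleCount := by
  rw [← Nat.card_eq_fintype_card, Nat.lt_iff_add_one_le, ← Finite.card_option]
  let v₀ := Classical.arbitrary F
  refine Nat.card_le_card_of_injective
    (fun o : Option A => Quotient.mk (SameCycle.setoid (G.orient ε))
      (o.elim (.inl v₀) fun a => .inr (a, 0))) fun a b h => ?_
  let g : F ⊕ A × Fin 3 → Option A := Sum.elim (fun _ => none) fun p => some p.1
  have hle : SameCycle.setoid (G.orient ε) ≤ Setoid.ker g := by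
    rw [sameCycle_setoid_le_iff]
    rintro (v | ⟨a, k⟩) <;> rfl
  have := hle (Quotient.exact h)
  rw [Setoid.ker_def] at this
  cases a <;> cases b <;> simp_all [g]

/-- Supplies the connectivity needed for the genus bound: `G.orient ε` follows oriented edges and
permutes the half-edges at each adjoint vertex transitively. -/
theorem Connected.setoid_eq_top {G : ColorGraph F A} (hG : G.Connected)
    (m : E × Bool ≃ F ⊕ A × Fin 3) (hm : ∀ e b, G.pair (m (e, b)) = m (e, !b)) (ε : A → Bool)
    (r : Setoid (F ⊕ A × Fin 3)) (h1 : ∀ x, r x (G.orient ε x))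
    (h2 : ∀ e, r (m (e, true)) (m (e, false))) : r = ⊤ := by
  have hpair : ∀ x, r x (G.pair x) := by
    intro x
    obtain ⟨⟨e, b⟩, rfl⟩ := m.surjective x
    rw [hm]
    cases b
    · exact r.symm' (h2 e)
    · exact h2 e
  let base : F ⊕ A → F ⊕ A × Fin 3 := Sum.elim Sum.inl fun a => .inr (a, 0)
  have hbase : ∀ x, r x (base (vertexOf x)) := by
    rintro (v | ⟨a, k⟩)
    · exact r.refl' _
    · change r _ (.inr (a, 0))
      have e0 := h1 (.inr (a, 0))
      have e1 := h1 (.inr (a, 1))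
      have e2 := h1 (.inr (a, 2))
      rw [orient_inr] at e0 e1 e2
      have t0 : cyclicTurn true 0 = 1 := by decide
      have t1 : cyclicTurn true 1 = 2 := by decide
      have t2 : cyclicTurn true 2 = 0 := by decide
      have f0 : cyclicTurn false 0 = 2 := by decide
      have f1 : cyclicTurn false 1 = 0 := by decide
      have f2 : cyclicTurn false 2 = 1 := by decide
      have hk : k = 0 ∨ k = 1 ∨ k = 2 := by revert k; decide
      cases hε : ε a <;> rw [hε] at e0 e1 e2
      · rw [f0] at e0; rw [f1] at e1; rw [f2] at e2
        rcases hk with rfl | rfl | rfl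
        · exact r.refl' _
        · exact e1
        · exact r.symm' e0
      · rw [t0] at e0; rw [t1] at e1; rw [t2] at e2
        rcases hk with rfl | rfl | rfl
        · exact r.refl' _
        · exact r.symm' e0
        · exact e2
  have hadj : ∀ x y, G.toSimpleGraph.Adj x y → r (base x) (base y) := by
    have key : ∀ x y, ((∃ v, x = .inl v ∧ y = .inl (G.next v)) ∨
        ∃ h, x = vertexOf h ∧ y = vertexOf (G.pair h)) → r (base x) (base y) := by
      rintro x y (⟨v, rfl, rfl⟩ | ⟨h, rfl, rfl⟩)
      · exact h1 (.inl v)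
      · exact r.trans' (r.symm' (hbase h)) (r.trans' (hpair h) (hbase _))
    intro x y hxy
    rw [toSimpleGraph, SimpleGraph.fromRel_adj] at hxy
    rcases hxy.2 with h | h
    · exact key x y h
    · exact r.symm' (key y x h)
  have hwalk : ∀ x y, G.toSimpleGraph.Walk x y → r (base x) (base y) := by
    intro x y w
    induction w with
    | nil => exact r.refl' _
    | cons h _ ih => exact r.trans' (hadj _ _ h) ih
  refine eq_top_iff.2 fun x y _ => ?_
  obtain ⟨w⟩ := hG.preconnected (vertexOf x) (vertexOf y)
  exact r.trans' (hbase x) (r.trans' (hwalk _ _ w) (r.symm' (hbase y)))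

open Classical in
theorem exists_of_mem_support_colorPolynomial [Fintype A] [Fintype E] {G : ColorGraph F A} {m : E × Bool ≃ F ⊕ A × Fin 3}
    {n : ℤ} (hn : n ∈ (G.colorPolynomial m).coeff.support) :
    ∃ (ε : A → Bool) (S : Finset E), IsAdmissible m S ∧
      n = ((flipOn m S * G.orient ε).cycleCount : ℤ) - (Sᶜ.card : ℤ) := by
  by_contra! hne
  rw [Finsupp.mem_support_iff] at hn
  apply hn
  rw [colorPolynomial]
  simp only [AddMonoidAlgebra.coeff_sum, Finsupp.finsetSum_apply]
  refine Finset.sum_eq_zero fun ε _ => Finset.sum_eq_zero fun S hS => ?_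
  rw [← LaurentPolynomial.single_eq_C_mul_T, AddMonoidAlgebra.coeff_single,
    Finsupp.single_eq_of_ne (hne ε S (Finset.mem_filter.1 hS).2)]

theorem le_of_mem_support_colorPolynomial [Fintype F] [Fintype A] [Fintype E] [Nonempty (F ⊕ A)] {G : ColorGraph F A}
    {m : E × Bool ≃ F ⊕ A × Fin 3} (hm : ∀ e b, G.pair (m (e, b)) = m (e, !b)) {n : ℤ}
    (hn : n ∈ (G.colorPolynomial m).coeff.support) : -(G.loopNumber : ℤ) + 2 ≤ n := by
  classical
  obtain ⟨ε, S, hS, rfl⟩ := exists_of_mem_support_colorPolynomial hn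
  have h1 := hS.two_mul_card_compl_le
  have h2 := G.card_edges_lt_loopNumber_add m hm
  have h3 := card_halfEdges m
  have : Nonempty (F ⊕ A × Fin 3) := by
    rcases ‹Nonempty (F ⊕ A)› with ⟨v | a⟩
    · exact ⟨.inl v⟩
    · exact ⟨.inr (a, 0)⟩
  -- The exponent is at least `1 - |F|/2`, while the edge counts give `h_G ≥ 1 + (|F| + |A|)/2`.
  have h4 := cycleCount_pos (flipOn m S * G.orient ε)
  omega

theorem mem_support_colorPolynomial_le [Fintype F] [Fintype A] [Fintype E] {G : ColorGraph F A} (hG : G.Connected)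
    {m : E × Bool ≃ F ⊕ A × Fin 3} (hm : ∀ e b, G.pair (m (e, b)) = m (e, !b)) {n : ℤ}
    (hn : n ∈ (G.colorPolynomial m).coeff.support) :
    n ≤ G.loopNumber + 1 ∧ (Nonempty F → n ≤ G.loopNumber) := by
  classical
  have := hG.nonempty
  obtain ⟨ε, S, hS, rfl⟩ := exists_of_mem_support_colorPolynomial hn
  have h1 := cycleCount_flipOn_mul_add_le m (G.orient ε) S (hG.setoid_eq_top m hm ε)
  have h2 := G.card_edges_lt_loopNumber_add m hm
  have h3 := S.card_add_card_compl
  have h4 := G.card_le_cycleCount_orient ε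
  -- The genus bound reads `n ≤ 2 + |E| - c(σ)`, where `|E| ≤ h_G + |A| - 1`. Each triangle is an
  -- orbit of `σ`; a fundamental vertex gives one more orbit.
  refine ⟨by omega, fun _ => ?_⟩
  have h5 := G.card_lt_cycleCount_orient ε
  omega

end ColorGraph

/-! ### Antisymmetry and vanishing by an odd symmetry -/

theorem structureConstant_swap_left {N : ℕ} (T : Fin (N ^ 2 - 1) → Matrix (Fin N) (Fin N) ℂ)
    (i j k : Fin (N ^ 2 - 1)) : structureConstant T j i k = -structureConstant T i j k := by
  rw [structureConstant, structureConstant, ← Matrix.trace_neg, ← Matrix.neg_mul, neg_sub]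

theorem structureConstant_rotate {N : ℕ} (T : Fin (N ^ 2 - 1) → Matrix (Fin N) (Fin N) ℂ)
    (i j k : Fin (N ^ 2 - 1)) : structureConstant T j k i = structureConstant T i j k := by
  rw [structureConstant, structureConstant, Matrix.sub_mul, Matrix.sub_mul, Matrix.trace_sub,
    Matrix.trace_sub]
  congr 1
  · exact Matrix.trace_mul_cycle ..
  · exact (Matrix.trace_mul_cycle ..).symm

theorem structureConstant_perm {N : ℕ} (T : Fin (N ^ 2 - 1) → Matrix (Fin N) (Fin N) ℂ)
    (π : Equiv.Perm (Fin 3)) (l : Fin 3 → Fin (N ^ 2 - 1)) :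
    structureConstant T (l (π 0)) (l (π 1)) (l (π 2)) =
      ((Equiv.Perm.sign π : ℤ) : ℂ) * structureConstant T (l 0) (l 1) (l 2) := by
  have hswap : ∀ (x y : Fin 3), x ≠ y → ∀ l : Fin 3 → Fin (N ^ 2 - 1),
      structureConstant T (l (Equiv.swap x y 0)) (l (Equiv.swap x y 1)) (l (Equiv.swap x y 2)) =
        -structureConstant T (l 0) (l 1) (l 2) := by
    intro x y hxy l
    have h01 := structureConstant_swap_left T (l 0) (l 1) (l 2)
    have h12 : structureConstant T (l 0) (l 2) (l 1) = -structureConstant T (l 0) (l 1) (l 2) := by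
      rw [← structureConstant_rotate, structureConstant_swap_left, structureConstant_rotate]
    have h02 : structureConstant T (l 2) (l 1) (l 0) = -structureConstant T (l 0) (l 1) (l 2) := by
      rw [structureConstant_swap_left, structureConstant_rotate]
    fin_cases x <;> fin_cases y <;> first | exact absurd rfl hxy | assumption
  induction π using Equiv.Perm.swap_induction_on generalizing l with
  | one => simp
  | swap_mul f x y hxy ih =>
    simp only [Equiv.Perm.mul_apply]
    rw [ih fun k => l (Equiv.swap x y k), hswap x y hxy, Equiv.Perm.sign_mul,
      Equiv.Perm.sign_swap hxy]
    simp

namespace ColorGraph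

variable {F A : Type*}

open Classical in
/-- An automorphism of the half-edge structure which permutes the adjoint vertices and acts
on their half-edges with total signature `-1` kills the contraction. -/
theorem contraction_eq_zero_of_odd_symmetry [Fintype F] [Fintype A] (G : ColorGraph F A)
    (ν : Equiv.Perm A) (w : A → Equiv.Perm (Fin 3)) (τ : F ⊕ A × Fin 3 → F ⊕ A × Fin 3)
    (hF : ∀ v, τ (.inl v) = .inl v) (hA : ∀ a k, τ (.inr (a, k)) = .inr (ν a, w a k))
    (hτ : ∀ h, τ (τ h) = h) (hpair : ∀ h, G.pair (τ h) = τ (G.pair h))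
    (hsign : ∏ a, Equiv.Perm.sign (w a) = -1) {N : ℕ}
    (T : Fin (N ^ 2 - 1) → Matrix (Fin N) (Fin N) ℂ) : G.contraction T = 0 := by
  let e : Equiv.Perm {i : F ⊕ A × Fin 3 → Fin (N ^ 2 - 1) // ∀ h, i (G.pair h) = i h} :=
    Function.Involutive.toPerm (fun i => ⟨fun h => i.1 (τ h), fun h => by
      change i.1 (τ (G.pair h)) = i.1 (τ h)
      rw [← hpair, i.2]⟩)
      fun i => Subtype.ext (funext fun h => congrArg i.1 (hτ h))
  have he : ∀ i h, (e i).1 h = i.1 (τ h) := fun _ _ => rfl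
  have hneg : G.contraction T = -G.contraction T := by
    conv_lhs => rw [contraction, ← Equiv.sum_comp e]
    rw [contraction, ← Finset.sum_neg_distrib]
    refine Finset.sum_congr rfl fun i _ => ?_
    rw [← Finset.sum_neg_distrib]
    refine Finset.sum_congr rfl fun x _ => ?_
    rw [← mul_neg]
    congr 1
    · simp only [he, hF]
    · simp only [he, hA]
      have h1 : ∀ a, structureConstant T (i.1 (.inr (ν a, w a 0))) (i.1 (.inr (ν a, w a 1)))
          (i.1 (.inr (ν a, w a 2))) = ((Equiv.Perm.sign (w a) : ℤ) : ℂ) * structureConstant T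
            (i.1 (.inr (ν a, 0))) (i.1 (.inr (ν a, 1))) (i.1 (.inr (ν a, 2))) := fun a =>
        structureConstant_perm T (w a) fun k => i.1 (.inr (ν a, k))
      simp only [h1]
      rw [Finset.prod_mul_distrib, Equiv.prod_comp ν fun a => structureConstant T (i.1 (.inr (a, 0)))
        (i.1 (.inr (a, 1))) (i.1 (.inr (a, 2))), ← Int.cast_prod, ← Units.coe_prod, hsign]
      simp
  exact self_eq_neg.1 hneg

theorem contraction_eq_zero_of_containsTwoThree [Fintype F] [Fintype A] (G : ColorGraph F A)
    (hG : G.ContainsTwoThree) {N : ℕ} (T : Fin (N ^ 2 - 1) → Matrix (Fin N) (Fin N) ℂ) :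
    G.contraction T = 0 := by
  classical
  obtain ⟨p, q, c, hpq, hc, h⟩ := hG
  choose hcp hcq h3 h4 using h
  choose ip jp hp using h3
  choose iq jq hq using h4
  have bij : ∀ (x : A) (i j : Fin 3 → Fin 3), (∀ k, G.pair (.inr (x, i k)) = .inr (c k, j k)) →
      Function.Bijective i := fun x i j h => Finite.injective_iff_bijective.1 fun k l hkl => by
    have := (h k).symm.trans ((congrArg (fun k => G.pair (.inr (x, k))) hkl).trans (h l))
    exact hc (congrArg Prod.fst (Sum.inr_injective this))
  obtain ⟨P, rfl⟩ : ∃ P : Equiv.Perm (Fin 3), ⇑P = ip := ⟨Equiv.ofBijective ip (bij p ip jp hp), rfl⟩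
  obtain ⟨Q, rfl⟩ : ∃ Q : Equiv.Perm (Fin 3), ⇑Q = iq := ⟨Equiv.ofBijective iq (bij q iq jq hq), rfl⟩
  have hj : ∀ k, jp k ≠ jq k := fun k hk => by
    have := G.pair.injective ((hp k).trans (hk ▸ (hq k).symm))
    exact hpq (congrArg Prod.fst (Sum.inr_injective this))
  have hp' : ∀ k, G.pair (.inr (c k, jp k)) = .inr (p, P k) := fun k => by rw [← hp, G.pair_pair]
  have hq' : ∀ k, G.pair (.inr (c k, jq k)) = .inr (q, Q k) := fun k => by rw [← hq, G.pair_pair]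
  let s : Fin 3 → A → Equiv.Perm (Fin 3) := fun k a =>
    if a = c k then Equiv.swap (jp k) (jq k) else 1
  -- The half-edges of `p` and `q` towards the same `c k` are exchanged, as are the two half-edges
  -- of `c k` towards `p` and `q`. The signs at `p` and `q` cancel, and the three transpositions
  -- leave `-1`, whatever the cyclic orders.
  let w : A → Equiv.Perm (Fin 3) := fun a =>
    (if a = p then Q * P⁻¹ else 1) * (if a = q then P * Q⁻¹ else 1) * (s 0 a * s 1 a * s 2 a)
  have wp : w p = Q * P⁻¹ := by simp [w, s, hpq, (hcp _).symm]
  have wq : w q = P * Q⁻¹ := by simp [w, s, hpq.symm, (hcq _).symm]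
  have wc : ∀ k, w (c k) = Equiv.swap (jp k) (jq k) := by
    intro k
    fin_cases k <;> simp [w, s, hcp, hcq, hc.eq_iff]
  have wo : ∀ a, a ≠ p → a ≠ q → (∀ k, a ≠ c k) → w a = 1 := by
    intro a h1 h2 h3
    simp [w, s, h1, h2, h3]
  let τ : F ⊕ A × Fin 3 → F ⊕ A × Fin 3 :=
    Sum.map id fun x => (Equiv.swap p q x.1, w x.1 x.2)
  have hτA : ∀ a k, τ (.inr (a, k)) = .inr (Equiv.swap p q a, w a k) := fun _ _ => rfl
  have τp : ∀ k, τ (.inr (p, P k)) = .inr (q, Q k) := fun k => by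
    simp [hτA, wp]
  have τq : ∀ k, τ (.inr (q, Q k)) = .inr (p, P k) := fun k => by
    simp [hτA, wq]
  have τcp : ∀ k, τ (.inr (c k, jp k)) = .inr (c k, jq k) := fun k => by
    rw [hτA, wc, Equiv.swap_apply_left, Equiv.swap_apply_of_ne_of_ne (hcp k) (hcq k)]
  have τcq : ∀ k, τ (.inr (c k, jq k)) = .inr (c k, jp k) := fun k => by
    rw [hτA, wc, Equiv.swap_apply_right, Equiv.swap_apply_of_ne_of_ne (hcp k) (hcq k)]
  -- `D` consists of the half-edges of the six edges of the `K_{2,3}`; it contains all half-edges of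
  -- `p` and `q`, so `τ` is the identity elsewhere.
  let D : F ⊕ A × Fin 3 → Prop := fun h => ∃ k, h = .inr (p, P k) ∨ h = .inr (q, Q k) ∨
    h = .inr (c k, jp k) ∨ h = .inr (c k, jq k)
  have τo : ∀ h, ¬ D h → τ h = h := by
    rintro (v | ⟨a, l⟩) hD
    · rfl
    · have hap : a ≠ p := by
        rintro rfl
        exact hD ⟨P.symm l, Or.inl (by simp)⟩
      have haq : a ≠ q := by
        rintro rfl
        exact hD ⟨Q.symm l, Or.inr (Or.inl (by simp))⟩
      rw [hτA, Equiv.swap_apply_of_ne_of_ne hap haq]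
      by_cases hac : ∃ k, a = c k
      · obtain ⟨k, rfl⟩ := hac
        rw [wc, Equiv.swap_apply_of_ne_of_ne]
        · rintro rfl
          exact hD ⟨k, by simp⟩
        · rintro rfl
          exact hD ⟨k, by simp⟩
      · rw [wo a hap haq fun k hk => hac ⟨k, hk⟩, Equiv.Perm.one_apply]
  have hD : ∀ h, D h → D (G.pair h) := by
    rintro _ ⟨k, rfl | rfl | rfl | rfl⟩
    · exact ⟨k, by simp [hp]⟩
    · exact ⟨k, by simp [hq]⟩
    · exact ⟨k, by simp [hp']⟩
    · exact ⟨k, by simp [hq']⟩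
  refine G.contraction_eq_zero_of_odd_symmetry (Equiv.swap p q) w τ (fun _ => rfl) hτA ?_ ?_ ?_ T
  · intro h
    by_cases hh : D h
    · obtain ⟨k, rfl | rfl | rfl | rfl⟩ := hh
      · rw [τp, τq]
      · rw [τq, τp]
      · rw [τcp, τcq]
      · rw [τcq, τcp]
    · rw [τo h hh, τo h hh]
  · intro h
    by_cases hh : D h
    · obtain ⟨k, rfl | rfl | rfl | rfl⟩ := hh
      · rw [τp, hp, hq, τcp]
      · rw [τq, hp, hq, τcq]
      · rw [τcp, hp', hq', τp]
      · rw [τcq, hp', hq', τq]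
    · rw [τo h hh, τo _ fun h' => hh (G.pair_pair h ▸ hD _ h')]
  · simp only [w, s, Equiv.Perm.sign_mul, apply_ite Equiv.Perm.sign, Equiv.Perm.sign_one,
      Finset.prod_mul_distrib, Finset.prod_ite_eq', Finset.mem_univ, if_true,
      Equiv.Perm.sign_swap (hj _), Equiv.Perm.sign_inv]
    rw [mul_comm (Equiv.Perm.sign P), Int.units_mul_self, one_mul]
    rfl

end ColorGraph

/-! ### The main theorem -/

/-- The color factor of a connected vacuum color graph with at least one vertex is a well-defined
Laurent polynomial with the listed properties. -/
theorem proposition2p6 {F A : Type*} [Fintype F] [Fintype A] (G : ColorGraph F A)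
    (hv : 1 ≤ G.numVertices) (hG : G.Connected) :
    (∃! R : LaurentPolynomial ℤ, G.IsColorFactor R) ∧
    ∀ R : LaurentPolynomial ℤ, G.IsColorFactor R →
      (LaurentPolynomial.T 2 - 1 ∣ R) ∧
      (G.ContainsTwoThree → R = 0) ∧
      ((∀ n ∈ R.coeff.support, -(G.loopNumber : ℤ) + 2 ≤ n) ∧
        (Nonempty F → R.degree ≤ ((G.loopNumber : ℤ) : WithBot ℤ)) ∧
        (IsEmpty F → R.degree ≤ ((G.loopNumber + 1 : ℤ) : WithBot ℤ))) ∧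
      substNeg R = (-1) ^ (G.numOrientedCycles + G.numEdges) * R := by
  classical
  have : Nonempty (F ⊕ A) := hG.nonempty
  obtain ⟨m, hm⟩ := Equiv.Perm.exists_matching G.pair G.pair_pair G.pair_ne
  have : Fintype (Quotient (Equiv.Perm.SameCycle.setoid G.pair)) := Fintype.ofFinite _
  have hcol := G.isColorFactor_colorPolynomial m hm
  refine ⟨⟨_, hcol, fun R hR => hR.eq hcol⟩, fun R hR => ?_⟩
  obtain rfl := hR.eq hcol
  have hneg : substNeg (G.colorPolynomial m) =
      (-1) ^ (G.numOrientedCycles + G.numEdges) * G.colorPolynomial m := by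
    rw [G.substNeg_colorPolynomial m, ColorGraph.numEdges, Nat.card_eq_fintype_card,
      Nat.card_eq_fintype_card]
  refine ⟨LaurentPolynomial.T_two_sub_one_dvd _ hR.eval₂_one ?_,
    fun h => hR.eq_zero fun N T => G.contraction_eq_zero_of_containsTwoThree h T,
    ⟨fun n hn => ColorGraph.le_of_mem_support_colorPolynomial hm hn, fun hF => ?_, fun _ => ?_⟩,
    hneg⟩
  -- The parity property carries the zero at `1` to `-1`.
  · rw [ColorGraph.eval₂_neg_one_eq, hneg, map_mul, hR.eval₂_one, mul_zero]
  · exact Finset.max_le fun n hn => WithBot.coe_le_coe.2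
      ((ColorGraph.mem_support_colorPolynomial_le hG hm hn).2 hF)
  · exact Finset.max_le fun n hn => WithBot.coe_le_coe.2
      (ColorGraph.mem_support_colorPolynomial_le hG hm hn).1
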